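/- Let $\mathbb C_+=\{z\in\mathbb C:\operatorname{Re}z>0\}$, let $\ell\ge 0$ be an integer and $a\in\mathbb R$. Let $A^2_\ell$ be the Hilbert space of analytic functions $h:\mathbb C_+\to\mathbb C$ with $$\|h\|^2=\frac1\pi\int_{-\infty}^{\infty}\int_0^\infty x^\ell|h(x+iy)|^2\,dx\,dy<\infty .$$ For analytic functions $f:\mathbb C_+\to\mathbb C$ and $g:\mathbb C_+\to\mathbb C_+$, let $W_{f,g,\max}$ be the maximal weighted composition operator on $A^2_\ell$: its domain is $\{h\in A^2_\ell: f\cdot(h\circ g)\in A^2_\ell\}$ and $W_{f,g,\max}h=f\cdot(h\circ g)$. Let $\mathcal C_a$ be the conjugation $\mathcal C_ah(z)=\overline{h(\overline z+ia)}$ on $A^2_\ell$. A densely defined operator $T$ on $A^2_\ell$ is called $\mathcal C_a$-selfadjoint if $T=\mathcal C_aT^*\mathcal C_a$ (with equality of domains), and bounded if its domain is all of $A^2_\ell$ and there is $L>0$ with $\|Th\|\le L\|h\|$ for all $h\in A^2_\ell$. **Theorem.** The operator $W_{f,g,\max}$ is $\mathcal C_a$-selfadjoint on $A^2_\ell$ if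 and only if $f$ vanishes identically or one of the following holds: 1. $g(w)=\mu$ and $f(w)=\dfrac{\delta}{(w+\mu-ia)^{\ell+2}}$ for all $w\in\mathbb C_+$, where $\mu\in\mathbb C_+$ and $\delta\in\mathbb C$; 2. $g(w)=w+\gamma$ and $f(w)=\lambda$ for all $w\in\mathbb C_+$, where $\gamma,\lambda\in\mathbb C$ and $\operatorname{Re}\gamma\ge 0$; 3. $g(w)=-\dfrac{\beta}{\alpha}-\dfrac{2}{\alpha(w-ia)-\beta}$ and $f(w)=\dfrac{\delta}{(\alpha(w-ia)-\beta)^{\ell+2}}$ for all $w\in\mathbb C_+$, where $\alpha\in\mathbb C\setminus\{0\}$, $\beta,\delta\in\mathbb C$, and either $$\operatorname{Re}\frac\beta\alpha=\operatorname{Im}\frac1\alpha=0,\quad \operatorname{Re}\frac1\alpha<0,$$ or $$\operatorname{Re}\frac\beta\alpha<0,\quad \Bigl(\operatorname{Re}\frac\beta\alpha\Bigr)^2\ge\operatorname{Re}\frac1\alpha+\frac1{|\alpha|}.$$ In this case, the operator $W_{f,g,\max}$ is bounded. -/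

import Mathlib

noncomputable section

open MeasureTheory

namespace BergmanHP

/-- The open right half-plane `{z ∈ ℂ : Re z > 0}`. -/
abbrev RHP : Type := {z : ℂ // 0 < z.re}

/-- A function on the right half-plane is analytic: it is the restriction of a function
`F : ℂ → ℂ` that is complex differentiable on the (open) half-plane. -/
def IsAnalytic (h : RHP → ℂ) : Prop :=
  ∃ F : ℂ → ℂ, DifferentiableOn ℂ F {z | 0 < z.re} ∧ ∀ z : RHP, F z = h z

/-- The measure `(1/π) x^ℓ dx dy` on the right half-plane (`z = x + iy`). -/
def bergmanMeasure (ℓ : ℕ) : Measure RHP :=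
  ENNReal.ofReal (Real.pi⁻¹) •
    ((volume : Measure ℂ).comap ((↑) : RHP → ℂ)).withDensity (fun z => ENNReal.ofReal ((z : ℂ).re ^ ℓ))

/-- The analytic functions on the right half-plane that are square integrable
against `(1/π) x^ℓ dx dy`. -/
def bergmanSubmodule (ℓ : ℕ) : Submodule ℂ (RHP → ℂ) where
  carrier := {h | IsAnalytic h ∧ MemLp h 2 (bergmanMeasure ℓ)}
  zero_mem' := ⟨⟨0, differentiableOn_const 0, fun _ => rfl⟩, MemLp.zero⟩
  add_mem' := by
    rintro h k ⟨⟨F, hF, hF'⟩, hm⟩ ⟨⟨G, hG, hG'⟩, km⟩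
    exact ⟨⟨F + G, hF.add hG, fun z => by simp [hF', hG']⟩, hm.add km⟩
  smul_mem' := by
    rintro c h ⟨⟨F, hF, hF'⟩, hm⟩
    exact ⟨⟨c • F, hF.const_smul c, fun z => by simp [hF']⟩, hm.const_smul c⟩

/-- The weighted Bergman space `A²_ℓ` of the right half-plane. -/
def Bergman (ℓ : ℕ) : Type := bergmanSubmodule ℓ

variable {ℓ : ℕ}

instance : AddCommGroup (Bergman ℓ) := inferInstanceAs (AddCommGroup (bergmanSubmodule ℓ))
instance : Module ℂ (Bergman ℓ) := inferInstanceAs (Module ℂ (bergmanSubmodule ℓ))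

instance : FunLike (Bergman ℓ) RHP ℂ where
  coe h := h.1
  coe_injective _ _ e := Subtype.ext e

theorem Bergman.mem (h : Bergman ℓ) : (h : RHP → ℂ) ∈ bergmanSubmodule ℓ := h.2
theorem Bergman.memLp (h : Bergman ℓ) : MemLp h 2 (bergmanMeasure ℓ) := h.2.2

@[simp] theorem Bergman.add_apply (h k : Bergman ℓ) (z : RHP) : (h + k) z = h z + k z := rfl
@[simp] theorem Bergman.sub_apply (h k : Bergman ℓ) (z : RHP) : (h - k) z = h z - k z := rfl
@[simp] theorem Bergman.smul_apply (c : ℂ) (h : Bergman ℓ) (z : RHP) : (c • h) z = c * h z := rfl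
@[simp] theorem Bergman.zero_apply (z : RHP) : (0 : Bergman ℓ) z = 0 := rfl

theorem IsAnalytic.continuous {h : RHP → ℂ} (hh : IsAnalytic h) : Continuous h := by
  obtain ⟨F, hF, hF'⟩ := hh
  have h1 : Continuous (fun z : RHP => F z) :=
    hF.continuousOn.comp_continuous continuous_subtype_val (fun z => z.2)
  exact h1.congr hF'

theorem measurableSet_halfPlane : MeasurableSet {z : ℂ | 0 < z.re} :=
  measurableSet_lt measurable_const Complex.measurable_re

theorem isOpen_halfPlane : IsOpen {z : ℂ | 0 < z.re} :=
  isOpen_lt continuous_const Complex.continuous_re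

theorem lintegral_bergmanMeasure (F : ℂ → ENNReal) (hF : Measurable fun z : RHP => F z) :
    ∫⁻ z : RHP, F z ∂(bergmanMeasure ℓ) = ENNReal.ofReal (Real.pi⁻¹) *
      ∫⁻ z in {z : ℂ | 0 < z.re}, ENNReal.ofReal (z.re ^ ℓ) * F z := by
  have hm : Measurable fun z : RHP => ENNReal.ofReal ((z : ℂ).re ^ ℓ) := by fun_prop
  rw [bergmanMeasure, lintegral_smul_measure, lintegral_withDensity_eq_lintegral_mul _ hm hF,
    smul_eq_mul]
  congr 1
  exact lintegral_subtype_comap measurableSet_halfPlane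
    (fun z : ℂ => ENNReal.ofReal (z.re ^ ℓ) * F z)

theorem Bergman.eq_zero_of_ae (h : Bergman ℓ) (e : (h : RHP → ℂ) =ᵐ[bergmanMeasure ℓ] 0) :
    h = 0 := by
  have hc : Continuous (h : RHP → ℂ) := h.mem.1.continuous
  have hm : Measurable fun z : RHP => ENNReal.ofReal ((z : ℂ).re ^ ℓ) := by fun_prop
  have e1 : ∀ᵐ z ∂((volume : Measure ℂ).comap ((↑) : RHP → ℂ)), h z = 0 := by
    have hpi : ENNReal.ofReal (Real.pi⁻¹) ≠ 0 := by
      simpa using Real.pi_pos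
    have e2 : ∀ᵐ z ∂(((volume : Measure ℂ).comap ((↑) : RHP → ℂ)).withDensity
        (fun z => ENNReal.ofReal ((z : ℂ).re ^ ℓ))), h z = 0 :=
      (Measure.ae_ennreal_smul_measure_iff hpi).1 e
    rw [ae_withDensity_iff hm] at e2
    filter_upwards [e2] with z hz
    exact hz (by simpa using pow_pos z.2 ℓ)
  have hop : ((volume : Measure ℂ).comap ((↑) : RHP → ℂ)).IsOpenPosMeasure := by
    refine ⟨fun U hU ⟨x, hx⟩ => ?_⟩
    have hval : ((volume : Measure ℂ).comap ((↑) : RHP → ℂ)) U =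
        volume (((↑) : RHP → ℂ) '' U) := comap_subtype_coe_apply measurableSet_halfPlane _ _
    rw [hval]
    exact ((isOpen_halfPlane.isOpenMap_subtype_val U hU).measure_pos _
      ⟨x, Set.mem_image_of_mem _ hx⟩).ne'
  have := Measure.eq_of_ae_eq (μ := (volume : Measure ℂ).comap ((↑) : RHP → ℂ))
    (f := (h : RHP → ℂ)) (g := fun _ => 0) e1 hc continuous_const
  exact DFunLike.coe_injective this

theorem Bergman.integrable_inner (h k : Bergman ℓ) :
    Integrable (fun z => (starRingEnd ℂ) (h z) * k z) (bergmanMeasure ℓ) :=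
  (h.memLp.star).integrable_mul k.memLp

theorem Bergman.conj_mul_self (h : Bergman ℓ) :
    ∫ z, (starRingEnd ℂ) (h z) * h z ∂(bergmanMeasure ℓ) =
      ((∫ z, ‖h z‖ ^ 2 ∂(bergmanMeasure ℓ) : ℝ) : ℂ) := by
  rw [← integral_complex_ofReal]
  congr 1
  ext z
  rw [Complex.conj_mul']
  norm_cast

/-- The inner product `⟨h, k⟩ = (1/π) ∫∫ x^ℓ h conj(k) dx dy`
(in Mathlib's convention, conjugate-linear in the first variable). -/
@[reducible] def bergmanCore (ℓ : ℕ) : InnerProductSpace.Core ℂ (Bergman ℓ) where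
  inner h k := ∫ z, (starRingEnd ℂ) (h z) * k z ∂(bergmanMeasure ℓ)
  conj_inner_symm h k := by
    rw [← integral_conj]
    simp [mul_comm]
  re_inner_nonneg h := by
    rw [h.conj_mul_self]
    exact integral_nonneg fun z => by positivity
  add_left h k l := by
    rw [← integral_add (h.integrable_inner l) (k.integrable_inner l)]
    simp [add_mul]
  smul_left h k c := by
    rw [← integral_const_mul]
    simp [mul_assoc]
  definite h e := by
    rw [h.conj_mul_self] at e
    have e' : ∫ z, ‖h z‖ ^ 2 ∂(bergmanMeasure ℓ) = 0 := by exact_mod_cast e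
    rw [integral_eq_zero_iff_of_nonneg (fun z => by positivity)
      (h.memLp.integrable_norm_pow (by norm_num))] at e'
    apply h.eq_zero_of_ae
    filter_upwards [e'] with z hz
    simpa using hz

instance : NormedAddCommGroup (Bergman ℓ) := (bergmanCore ℓ).toNormedAddCommGroup
instance : InnerProductSpace ℂ (Bergman ℓ) := InnerProductSpace.ofCore (bergmanCore ℓ).toCore

theorem Bergman.inner_def (h k : Bergman ℓ) :
    inner ℂ h k = ∫ z, (starRingEnd ℂ) (h z) * k z ∂(bergmanMeasure ℓ) := rfl

/-- The embedding of the Bergman space in `L²`. -/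
def Bergman.toLp (ℓ : ℕ) : Bergman ℓ →ₗᵢ[ℂ] Lp ℂ 2 (bergmanMeasure ℓ) :=
  LinearMap.isometryOfInner
    { toFun := fun h => h.memLp.toLp
      map_add' := fun h k => MemLp.toLp_add h.memLp k.memLp
      map_smul' := fun c h => MemLp.toLp_const_smul c h.memLp } (by
    intro h k
    rw [L2.inner_def, Bergman.inner_def]
    apply integral_congr_ae
    filter_upwards [h.memLp.coeFn_toLp, k.memLp.coeFn_toLp] with z hz kz
    change inner ℂ ((h.memLp.toLp _ : Lp ℂ 2 (bergmanMeasure ℓ)) z)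
      ((k.memLp.toLp _ : Lp ℂ 2 (bergmanMeasure ℓ)) z) = _
    rw [hz, kz, RCLike.inner_apply, mul_comm])

theorem Bergman.enorm_sq (h : Bergman ℓ) :
    ‖h‖ₑ ^ 2 = ∫⁻ z, ‖h z‖ₑ ^ 2 ∂(bergmanMeasure ℓ) := by
  have h1 : ‖h‖ₑ = eLpNorm h 2 (bergmanMeasure ℓ) := by
    rw [← (Bergman.toLp ℓ).enorm_map h]
    exact Lp.enorm_toLp h.memLp
  rw [h1]
  have := eLpNorm_nnreal_pow_eq_lintegral (f := (h : RHP → ℂ)) (μ := bergmanMeasure ℓ)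
    (p := 2) (by norm_num)
  norm_num at this
  exact this

/-- Sub-mean value property of `|F|²` over a disc. -/
theorem sq_le_lintegral_ball {F : ℂ → ℂ} {c : ℂ} {R : ℝ} (hR : 0 < R)
    (hF : DifferentiableOn ℂ F (Metric.ball c R)) :
    ENNReal.ofReal (Real.pi * R ^ 2) * ‖F c‖ₑ ^ 2 ≤ ∫⁻ z in Metric.ball c R, ‖F z‖ₑ ^ 2 := by
  have key : ∀ r ∈ Set.Ioo 0 R, ENNReal.ofReal (2 * Real.pi) * ‖F c‖ₑ ^ 2 ≤
      ∫⁻ θ in Set.Ioo (-Real.pi) Real.pi, ‖F (circleMap c r θ)‖ₑ ^ 2 := by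
    intro r hr
    have hG : DiffContOnCl ℂ (fun z => F z ^ 2) (Metric.ball c |r|) := by
      apply DifferentiableOn.diffContOnCl
      rw [abs_of_pos hr.1]
      exact (hF.pow 2).mono
        (Metric.closure_ball_subset_closedBall.trans (Metric.closedBall_subset_ball hr.2))
    have h1 := hG.circleAverage
    rw [Real.circleAverage_eq_integral_add (-Real.pi)] at h1
    have h2 := intervalIntegral.integral_comp_add_right (a := 0) (b := 2 * Real.pi)
      (fun θ => F (circleMap c r θ) ^ 2) (-Real.pi)
    rw [show (0 : ℝ) + -Real.pi = -Real.pi by ring,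
      show 2 * Real.pi + -Real.pi = Real.pi by ring] at h2
    rw [h2] at h1
    have hpi := Real.pi_pos
    have h3 : ∫ θ in (-Real.pi)..Real.pi, F (circleMap c r θ) ^ 2 =
        (2 * Real.pi) • F c ^ 2 := by
      rw [← h1, smul_smul, mul_inv_cancel₀ (by positivity), one_smul]
    have h4 : ENNReal.ofReal (2 * Real.pi) * ‖F c‖ₑ ^ 2 =
        ‖∫ θ in (-Real.pi)..Real.pi, F (circleMap c r θ) ^ 2‖ₑ := by
      rw [h3, enorm_smul, enorm_pow, Real.enorm_of_nonneg (by positivity)]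
    rw [h4, intervalIntegral.integral_of_le (by linarith), integral_Ioc_eq_integral_Ioo]
    refine (enorm_integral_le_lintegral_enorm _).trans (le_of_eq ?_)
    simp_rw [enorm_pow]
  set φ : ℂ → ENNReal := (Metric.ball c R).indicator (fun z => ‖F z‖ₑ ^ 2) with hφ
  have hφm : Measurable φ := by
    have : φ = fun z => ‖(Metric.ball c R).indicator F z‖ₑ ^ 2 := by
      ext z
      by_cases hz : z ∈ Metric.ball c R <;> simp [hφ, hz]
    rw [this]
    have hm : Measurable ((Metric.ball c R).indicator F) := by
      classical
      have h0 := ContinuousOn.measurable_piecewise (s := Metric.ball c R) (f := F)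
        (g := fun _ => (0 : ℂ)) hF.continuousOn continuousOn_const measurableSet_ball
      exact h0
    fun_prop
  rw [← lintegral_indicator measurableSet_ball, ← hφ,
    ← lintegral_add_left_eq_self φ c, ← Complex.lintegral_comp_polarCoord_symm,
    polarCoord_target, Measure.volume_eq_prod, ← Measure.prod_restrict,
    lintegral_prod]
  swap
  · apply Measurable.aemeasurable
    simp only [Complex.polarCoord_symm_apply, smul_eq_mul]
    fun_prop
  have h5 : ∀ r ∈ Set.Ioo 0 R, ENNReal.ofReal r * (ENNReal.ofReal (2 * Real.pi) * ‖F c‖ₑ ^ 2) ≤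
      ∫⁻ θ in Set.Ioo (-Real.pi) Real.pi,
        ENNReal.ofReal r • φ (c + Complex.polarCoord.symm (r, θ)) := by
    intro r hr
    simp only [smul_eq_mul]
    rw [lintegral_const_mul' _ _ ENNReal.ofReal_ne_top]
    gcongr
    refine (key r hr).trans (le_of_eq ?_)
    apply lintegral_congr
    intro θ
    have e1 : c + Complex.polarCoord.symm (r, θ) = circleMap c r θ := by
      simp [circleMap, Complex.exp_mul_I]
    have e2 : circleMap c r θ ∈ Metric.ball c R := by
      simp [circleMap, abs_of_pos hr.1, hr.2]
    rw [e1, hφ, Set.indicator_of_mem e2]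
  calc ENNReal.ofReal (Real.pi * R ^ 2) * ‖F c‖ₑ ^ 2
      = ∫⁻ r in Set.Ioo 0 R, ENNReal.ofReal r * (ENNReal.ofReal (2 * Real.pi) * ‖F c‖ₑ ^ 2) := by
        rw [lintegral_mul_const _ (by fun_prop), ← mul_assoc]
        congr 1
        rw [← ofReal_integral_eq_lintegral_ofReal]
        · rw [← integral_Ioc_eq_integral_Ioo, ← intervalIntegral.integral_of_le hR.le,
            integral_id, ← ENNReal.ofReal_mul (by norm_num; positivity)]
          congr 1
          ring
        · exact (continuous_id.integrableOn_Icc (a := 0) (b := R)).mono_set Set.Ioo_subset_Icc_self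
        · filter_upwards [ae_restrict_mem measurableSet_Ioo] with r hr using hr.1.le
    _ ≤ ∫⁻ r in Set.Ioo 0 R, ∫⁻ θ in Set.Ioo (-Real.pi) Real.pi,
        ENNReal.ofReal r • φ (c + Complex.polarCoord.symm (r, θ)) :=
        setLIntegral_mono' measurableSet_Ioo h5
    _ ≤ _ := lintegral_mono_set Set.Ioo_subset_Ioi_self

/-- Point evaluations are locally uniformly bounded on the Bergman space. -/
theorem Bergman.exists_eval_bound (ℓ : ℕ) (z₀ : RHP) : ∃ C : ℝ, 0 < C ∧
    ∀ z : RHP, (z : ℂ) ∈ Metric.ball (z₀ : ℂ) ((z₀ : ℂ).re / 4) →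
      ∀ h : Bergman ℓ, ‖h z‖ ≤ C * ‖h‖ := by
  have hz₀ : 0 < (z₀ : ℂ).re := z₀.2
  set R : ℝ := (z₀ : ℂ).re / 4 with hR
  have hR0 : 0 < R := by positivity
  have hpi := Real.pi_pos
  set A : ℝ := Real.pi⁻¹ * ((2 * R) ^ ℓ * (Real.pi * R ^ 2)) with hA
  have hA0 : 0 < A := by positivity
  refine ⟨(Real.sqrt A)⁻¹, by positivity, fun z hz h => ?_⟩
  obtain ⟨F, hF, hF'⟩ := h.mem.1
  have hre : ∀ w ∈ Metric.ball (z : ℂ) R, 2 * R ≤ w.re := by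
    intro w hw
    have h1 : |(w - z₀).re| ≤ ‖w - z₀‖ := Complex.abs_re_le_norm _
    have h2 : ‖w - z₀‖ ≤ dist w z + dist (z : ℂ) z₀ := by
      rw [← dist_eq_norm]
      exact dist_triangle _ _ _
    have h3 := Metric.mem_ball.1 hw
    have h4 := Metric.mem_ball.1 hz
    rw [Complex.sub_re] at h1
    have h5 := neg_abs_le (w.re - (z₀ : ℂ).re)
    linarith
  have hsub : Metric.ball (z : ℂ) R ⊆ {w : ℂ | 0 < w.re} := fun w hw =>
    lt_of_lt_of_le (by positivity) (hre w hw)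
  have h1 := sq_le_lintegral_ball hR0 (hF.mono hsub)
  have hmeas : Measurable fun w : RHP => ‖F w‖ₑ ^ 2 := by
    simp_rw [hF']
    have := h.mem.1.continuous.measurable
    fun_prop
  have h2 : ‖h‖ₑ ^ 2 = ENNReal.ofReal (Real.pi⁻¹) *
      ∫⁻ w in {w : ℂ | 0 < w.re}, ENNReal.ofReal (w.re ^ ℓ) * ‖F w‖ₑ ^ 2 := by
    rw [h.enorm_sq, ← lintegral_bergmanMeasure _ hmeas]
    simp_rw [hF']
  have h3 : ENNReal.ofReal A * ‖h z‖ₑ ^ 2 ≤ ‖h‖ₑ ^ 2 := by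
    rw [h2, hA, ENNReal.ofReal_mul (by positivity), mul_assoc]
    gcongr
    calc ENNReal.ofReal ((2 * R) ^ ℓ * (Real.pi * R ^ 2)) * ‖h z‖ₑ ^ 2
        = ENNReal.ofReal ((2 * R) ^ ℓ) * (ENNReal.ofReal (Real.pi * R ^ 2) * ‖F z‖ₑ ^ 2) := by
          rw [ENNReal.ofReal_mul (by positivity), mul_assoc, hF']
      _ ≤ ENNReal.ofReal ((2 * R) ^ ℓ) * ∫⁻ w in Metric.ball (z : ℂ) R, ‖F w‖ₑ ^ 2 := by
          gcongr
      _ = ∫⁻ w in Metric.ball (z : ℂ) R, ENNReal.ofReal ((2 * R) ^ ℓ) * ‖F w‖ₑ ^ 2 :=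
          (lintegral_const_mul' _ _ ENNReal.ofReal_ne_top).symm
      _ ≤ ∫⁻ w in Metric.ball (z : ℂ) R, ENNReal.ofReal (w.re ^ ℓ) * ‖F w‖ₑ ^ 2 := by
          refine setLIntegral_mono' measurableSet_ball fun w hw => ?_
          have := hre w hw
          gcongr
      _ ≤ _ := lintegral_mono_set hsub
  have h4 : A * ‖h z‖ ^ 2 ≤ ‖h‖ ^ 2 := by
    rw [← ofReal_norm, ← ofReal_norm, ← ENNReal.ofReal_pow (norm_nonneg _),
      ← ENNReal.ofReal_pow (norm_nonneg _), ← ENNReal.ofReal_mul hA0.le,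
      ENNReal.ofReal_le_ofReal_iff (by positivity)] at h3
    exact h3
  have h5 : Real.sqrt A * ‖h z‖ ≤ ‖h‖ := by
    apply le_of_sq_le_sq _ (norm_nonneg _)
    rw [mul_pow, Real.sq_sqrt hA0.le]
    exact h4
  rw [inv_mul_eq_div, le_div_iff₀ (by positivity), mul_comm]
  exact h5

instance : CompleteSpace (Bergman ℓ) := by
  refine Metric.complete_of_cauchySeq_tendsto fun u hu => ?_
  have hlim : ∀ z : RHP, ∃ c : ℂ, Filter.Tendsto (fun n => u n z) Filter.atTop (nhds c) := by
    intro z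
    obtain ⟨C, hC, hb⟩ := Bergman.exists_eval_bound ℓ z
    apply cauchySeq_tendsto_of_complete
    rw [Metric.cauchySeq_iff'] at hu ⊢
    intro ε hε
    obtain ⟨N, hN⟩ := hu (ε / C) (by positivity)
    refine ⟨N, fun n hn => ?_⟩
    have h1 := hb z (Metric.mem_ball_self (by have := z.2; positivity)) (u n - u N)
    have h2 := hN n hn
    rw [dist_eq_norm] at h2 ⊢
    rw [Bergman.sub_apply] at h1
    rw [lt_div_iff₀ hC, mul_comm] at h2
    exact h1.trans_lt h2
  choose L hL using hlim
  choose F hF hF' using fun n => (u n).mem.1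
  have hLan : IsAnalytic L := by
    classical
    refine ⟨fun z => if h : 0 < z.re then L ⟨z, h⟩ else 0, ?_, fun z => dif_pos z.2⟩
    refine TendstoLocallyUniformlyOn.differentiableOn (F := F) (φ := Filter.atTop) ?_
      (Filter.Eventually.of_forall hF) isOpen_halfPlane
    rw [Metric.tendstoLocallyUniformlyOn_iff]
    intro ε hε z hz
    obtain ⟨C, hC, hb⟩ := Bergman.exists_eval_bound ℓ ⟨z, hz⟩
    have hz' : 0 < z.re := hz
    refine ⟨Metric.ball z (z.re / 4) ∩ {w | 0 < w.re},
      Filter.inter_mem (mem_nhdsWithin_of_mem_nhds (Metric.ball_mem_nhds _ (by positivity)))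
        self_mem_nhdsWithin, ?_⟩
    rw [Metric.cauchySeq_iff] at hu
    obtain ⟨N, hN⟩ := hu (ε / 2 / C) (by positivity)
    filter_upwards [Filter.eventually_ge_atTop N] with n hn w hw
    have hw' : 0 < w.re := hw.2
    simp only [hw', dif_pos]
    rw [hF' n ⟨w, hw'⟩]
    refine lt_of_le_of_lt (b := ε / 2) ?_ (by linarith)
    refine le_of_tendsto ((hL ⟨w, hw'⟩).dist tendsto_const_nhds) ?_
    filter_upwards [Filter.eventually_ge_atTop N] with m hm
    have h1 := hb ⟨w, hw'⟩ hw.1 (u m - u n)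
    have h2 := hN m hm n hn
    rw [dist_eq_norm] at h2 ⊢
    rw [Bergman.sub_apply] at h1
    rw [lt_div_iff₀ hC, mul_comm] at h2
    exact (h1.trans_lt h2).le
  obtain ⟨G, hG⟩ := cauchySeq_tendsto_of_complete
    ((Bergman.toLp ℓ).isometry.uniformContinuous.comp_cauchySeq hu)
  have hae : ∀ n, (Bergman.toLp ℓ (u n) : RHP → ℂ) =ᵐ[bergmanMeasure ℓ] u n :=
    fun n => (u n).memLp.coeFn_toLp
  obtain ⟨ns, hns, hns'⟩ := (tendstoInMeasure_of_tendsto_Lp hG).exists_seq_tendsto_ae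
  have hGL : (G : RHP → ℂ) =ᵐ[bergmanMeasure ℓ] L := by
    filter_upwards [hns', ae_all_iff.2 hae] with z hz1 hz2
    refine tendsto_nhds_unique hz1 (((hL z).comp hns.tendsto_atTop).congr fun n => ?_)
    exact (hz2 (ns n)).symm
  have hLm : MemLp L 2 (bergmanMeasure ℓ) := (Lp.memLp G).ae_eq hGL
  let v : Bergman ℓ := ⟨L, hLan, hLm⟩
  have hv : Bergman.toLp ℓ v = G := by
    apply Lp.ext
    exact (hLm.coeFn_toLp).trans hGL.symm
  refine ⟨v, ?_⟩
  rw [(Bergman.toLp ℓ).isometry.isEmbedding.tendsto_nhds_iff, hv]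
  exact hG

/-- The reflection `z ↦ conj z + i a` of the right half-plane. -/
def reflect (a : ℝ) (z : RHP) : RHP :=
  ⟨(starRingEnd ℂ) (z : ℂ) + Complex.I * a, by simpa using z.2⟩

theorem measurePreserving_reflect (ℓ : ℕ) (a : ℝ) :
    MeasurePreserving (reflect a) (bergmanMeasure ℓ) (bergmanMeasure ℓ) := by
  have hm : Measurable (reflect a) := by
    unfold reflect
    fun_prop
  have hT : MeasurePreserving (fun z : ℂ => (starRingEnd ℂ) z + Complex.I * a) volume volume :=
    (measurePreserving_add_right volume (Complex.I * (a : ℂ))).comp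
      Complex.conjLIE.measurePreserving
  refine ⟨hm, ?_⟩
  ext s hs
  have hind : Measurable ((((↑) : RHP → ℂ) '' s).indicator (1 : ℂ → ENNReal)) :=
    measurable_one.indicator
      ((MeasurableEmbedding.subtype_coe measurableSet_halfPlane).measurableSet_image.2 hs)
  have key : ∀ z : ℂ, ∀ hz : 0 < z.re, (z ∈ ((↑) : RHP → ℂ) '' s ↔ (⟨z, hz⟩ : RHP) ∈ s) := by
    intro z hz
    constructor
    · rintro ⟨w, hw, rfl⟩
      exact hw
    · intro h
      exact ⟨_, h, rfl⟩
  rw [Measure.map_apply hm hs, ← lintegral_indicator_one (hm hs), ← lintegral_indicator_one hs]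
  set J : ℂ → ENNReal := (((↑) : RHP → ℂ) '' s).indicator 1 with hJ
  have e1 : ∀ z : RHP, s.indicator (1 : RHP → ENNReal) z = J z := by
    intro z
    by_cases hz : z ∈ s
    · rw [Set.indicator_of_mem hz, hJ, Set.indicator_of_mem ((key z z.2).2 hz)]
      rfl
    · rw [Set.indicator_of_notMem hz, hJ, Set.indicator_of_notMem (fun h => hz ((key z z.2).1 h))]
  have e2 : ∀ z : RHP, (reflect a ⁻¹' s).indicator (1 : RHP → ENNReal) z =
      J ((starRingEnd ℂ) (z : ℂ) + Complex.I * a) := by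
    intro z
    exact e1 (reflect a z)
  simp_rw [e1, e2]
  rw [lintegral_bergmanMeasure J (hind.comp measurable_subtype_coe),
    lintegral_bergmanMeasure (fun z => J ((starRingEnd ℂ) z + Complex.I * a))
      (hind.comp (hT.measurable.comp measurable_subtype_coe))]
  congr 1
  rw [← lintegral_indicator measurableSet_halfPlane, ← lintegral_indicator measurableSet_halfPlane]
  have hfull : Measurable (Set.indicator {z : ℂ | 0 < z.re}
      fun z => ENNReal.ofReal (z.re ^ ℓ) * J z) := by
    refine Measurable.indicator ?_ measurableSet_halfPlane
    fun_prop
  rw [← hT.lintegral_comp hfull]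
  apply lintegral_congr
  intro z
  by_cases hz : 0 < z.re <;> simp [Set.indicator, hz]

/-- The conjugation `C_a h(z) = conj (h (conj z + i a))` on the Bergman space, as an
anti-linear map. -/
def conjugation (ℓ : ℕ) (a : ℝ) : Bergman ℓ →ₗ⋆[ℂ] Bergman ℓ where
  toFun h := ⟨fun z => (starRingEnd ℂ) (h (reflect a z)), by
    refine ⟨?_, (h.memLp.comp_measurePreserving (measurePreserving_reflect ℓ a)).star⟩
    obtain ⟨F, hF, hF'⟩ := h.mem.1
    refine ⟨fun z => (starRingEnd ℂ) (F ((starRingEnd ℂ) z + Complex.I * a)), ?_,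
      fun z => congrArg (starRingEnd ℂ) (hF' (reflect a z))⟩
    intro z hz
    have hz' : 0 < ((starRingEnd ℂ) z + Complex.I * a).re := by simpa using hz
    have h1 : DifferentiableAt ℂ F ((starRingEnd ℂ) z + Complex.I * a) :=
      hF.differentiableAt (isOpen_halfPlane.mem_nhds hz')
    have h2 : DifferentiableAt ℂ (fun w => F (w + Complex.I * a)) ((starRingEnd ℂ) z) :=
      DifferentiableAt.comp (g := F) (f := fun w => w + Complex.I * a) _ h1
        (differentiableAt_id.add_const _)
    have h3 := h2.conj_conj
    rw [Complex.conj_conj] at h3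
    exact h3.differentiableWithinAt⟩
  map_add' h k := by
    apply DFunLike.coe_injective
    funext z
    exact map_add (starRingEnd ℂ) _ _
  map_smul' c h := by
    apply DFunLike.coe_injective
    funext z
    exact map_mul (starRingEnd ℂ) _ _

theorem conjugation_apply (a : ℝ) (h : Bergman ℓ) (z : RHP) :
    conjugation ℓ a h z = (starRingEnd ℂ) (h (reflect a z)) := rfl

/-- The maximal weighted composition operator `W_{f,g,max} h = f · (h ∘ g)`, whose domain
consists of all `h` in the Bergman space with `f · (h ∘ g)` in the Bergman space. -/
def wcompMax (ℓ : ℕ) (f : RHP → ℂ) (g : RHP → RHP) : Bergman ℓ →ₗ.[ℂ] Bergman ℓ where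
  domain :=
    { carrier := {h | (fun z => f z * h (g z)) ∈ bergmanSubmodule ℓ}
      zero_mem' := by
        have : (fun z => f z * (0 : Bergman ℓ) (g z)) = 0 := by
          funext z
          simp
        rw [Set.mem_ofPred_eq, this]
        exact (bergmanSubmodule ℓ).zero_mem
      add_mem' := by
        intro h k hh hk
        have : (fun z => f z * (h + k) (g z)) =
            (fun z => f z * h (g z)) + fun z => f z * k (g z) := by
          funext z
          simp [mul_add]
        rw [Set.mem_ofPred_eq, this]
        exact (bergmanSubmodule ℓ).add_mem hh hk
      smul_mem' := by
        intro c h hh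
        have : (fun z => f z * (c • h) (g z)) = c • fun z => f z * h (g z) := by
          funext z
          simp [mul_left_comm]
        rw [Set.mem_ofPred_eq, this]
        exact (bergmanSubmodule ℓ).smul_mem c hh }
  toFun :=
    { toFun := fun h => ⟨fun z => f z * (h : Bergman ℓ) (g z), h.2⟩
      map_add' := fun h k => by
        apply DFunLike.coe_injective
        funext z
        exact mul_add _ _ _
      map_smul' := fun c h => by
        apply DFunLike.coe_injective
        funext z
        exact mul_left_comm _ _ _ }

/-- For an anti-linear map `C` and an operator `T` with domain `dom T`, the operator `C T C`
with domain `{h | C h ∈ dom T}`. -/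
def sandwich {E : Type*} [AddCommGroup E] [Module ℂ E] (C : E →ₗ⋆[ℂ] E) (T : E →ₗ.[ℂ] E) :
    E →ₗ.[ℂ] E where
  domain := T.domain.comap C
  toFun :=
    { toFun := fun h => C (T ⟨C h, h.2⟩)
      map_add' := fun h k => by
        rw [← map_add, ← T.map_add]
        congr 2
        exact Subtype.ext (map_add C _ _)
      map_smul' := fun c h => by
        have : T ⟨C (c • h : T.domain.comap C), (c • h).2⟩ =
            (starRingEnd ℂ) c • T ⟨C h, h.2⟩ := by
          rw [← T.map_smul]
          congr 1
          exact Subtype.ext (map_smulₛₗ C c _)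
        rw [this, map_smulₛₗ]
        simp }

/-- A densely defined operator `T` on a Hilbert space is `C`-selfadjoint if `T = C T* C`,
equality of domains included. -/
def IsCSelfadjoint {E : Type*} [NormedAddCommGroup E] [InnerProductSpace ℂ E] [CompleteSpace E]
    (C : E →ₗ⋆[ℂ] E) (T : E →ₗ.[ℂ] E) : Prop :=
  Dense (T.domain : Set E) ∧ T = sandwich C T.adjoint

/-- An operator is bounded if it is everywhere defined and `‖T h‖ ≤ L ‖h‖` for some `L > 0`. -/
def IsBoundedOp {E : Type*} [NormedAddCommGroup E] [InnerProductSpace ℂ E]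
    (T : E →ₗ.[ℂ] E) : Prop :=
  T.domain = ⊤ ∧ ∃ L : ℝ, 0 < L ∧ ∀ h : T.domain, ‖T h‖ ≤ L * ‖(h : E)‖

end BergmanHP

end

noncomputable section

open MeasureTheory

namespace BergmanHP

variable {ℓ : ℕ}

/-! The space has the reproducing kernel `k_w(z) = 2^ℓ (ℓ+1) / (z + conj w)^(ℓ+2)` (`inner_kernel`).
The adjoint of the weighted composition operator sends `k_w` to `conj (f w) • k_(g w)`, even when
the operator is unbounded, and the conjugation permutes the kernels. Testing selfadjointness on
kernels therefore gives a functional equation for the symbols alone, `f(z) (z + g(u) - ia)^(ℓ+2) =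
f(u) (u + g(z) - ia)^(ℓ+2)` (`symbolSymm_of_isCSelfadjoint`). For a bounded operator the equation is
also sufficient, since kernels detect point values (`isCSelfadjoint_of_symbolSymm`).

To solve the equation when `f` is not identically zero, combine three instances of it so that `f`
cancels. What remains says that a continuous quotient built from `g` has `(ℓ+2)`-th power `1`; the
half-plane is connected, so the quotient is constantly `1`. With two arguments frozen this is a
bilinear relation between `z` and `g(z)`, so `g` is a translation, a constant, or a Möbius map `b -
e / (z - ia + b)`, and `f` is then read off from the equation (`SymbolSymm.classification`). The
conditions on `b` and `e` say exactly that the Möbius map preserves the half-plane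
(`re_conditions_of_forall_pos`).

Conversely, each solution gives a bounded operator. For constant `g` this is point evaluation times
a kernel. In the other cases `|f|²` is a constant multiple of `|g'|^(ℓ+2)`, so the Schwarz–Pick
inequality and the change of variables by `g` bound the norm (`isBoundedOp_of_injOn`). Boundedness
thus comes with the classification, and it also disposes of the question of domains in the converse.
-/

/-! ### Weighted integrals on the half-plane and on the disc -/

theorem integral_bergmanMeasure {E : Type*} [NormedAddCommGroup E] [NormedSpace ℝ E]
    (F : ℂ → E) :
    ∫ z : RHP, F z ∂(bergmanMeasure ℓ) =
      Real.pi⁻¹ • ∫ z in {z : ℂ | 0 < z.re}, z.re ^ ℓ • F z := by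
  have hm : Measurable fun z : RHP => ENNReal.ofReal ((z : ℂ).re ^ ℓ) := by fun_prop
  rw [bergmanMeasure, integral_smul_measure,
    integral_withDensity_eq_integral_toReal_smul hm (by simp),
    ENNReal.toReal_ofReal (by positivity)]
  congr 1
  rw [← integral_subtype_comap measurableSet_halfPlane (fun z : ℂ => z.re ^ ℓ • F z)]
  refine integral_congr_ae (Filter.Eventually.of_forall fun z => ?_)
  simp only
  rw [ENNReal.toReal_ofReal (pow_nonneg z.2.le ℓ)]

theorem integrable_bergmanMeasure_iff {E : Type*} [NormedAddCommGroup E] [NormedSpace ℝ E]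
    (F : ℂ → E) :
    Integrable (fun z : RHP => F z) (bergmanMeasure ℓ) ↔
      IntegrableOn (fun z : ℂ => z.re ^ ℓ • F z) {z : ℂ | 0 < z.re} := by
  have hm : Measurable fun z : RHP => ENNReal.ofReal ((z : ℂ).re ^ ℓ) := by fun_prop
  rw [bergmanMeasure, integrable_smul_measure (by simpa using Real.pi_pos) (by simp),
    integrable_withDensity_iff_integrable_smul' hm (by simp),
    integrableOn_iff_comap_subtypeVal measurableSet_halfPlane]
  refine integrable_congr (Filter.Eventually.of_forall fun z => ?_)
  simp only [Function.comp]
  rw [ENNReal.toReal_ofReal (pow_nonneg z.2.le ℓ)]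

theorem integral_mul_one_sub_sq_pow (ℓ : ℕ) :
    ∫ r in (0 : ℝ)..1, r * (1 - r ^ 2) ^ ℓ = (2 * (ℓ + 1) : ℝ)⁻¹ := by
  have h : ∀ r ∈ Set.uIcc (0 : ℝ) 1, HasDerivAt
      (fun r : ℝ => -(1 - r ^ 2) ^ (ℓ + 1) / (2 * (ℓ + 1))) (r * (1 - r ^ 2) ^ ℓ) r := by
    intro r _
    have h1 := ((((hasDerivAt_id r).pow 2).const_sub 1).pow (ℓ + 1)).neg.div_const
      (2 * (ℓ + 1) : ℝ)
    have : (ℓ : ℝ) + 1 ≠ 0 := by positivity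
    refine HasDerivAt.congr_deriv h1 ?_
    simp only [id, Pi.pow_apply, Nat.add_sub_cancel]
    push_cast
    field_simp
  rw [intervalIntegral.integral_eq_sub_of_hasDerivAt h
    (Continuous.intervalIntegrable (by fun_prop) _ _)]
  simp
  field_simp

/-- Mean value property on the unit disc for the radial weight `(1 - |ζ|²)^ℓ`. -/
theorem integral_ball_radial_smul {H : ℂ → ℂ} (hH : DifferentiableOn ℂ H (Metric.ball 0 1))
    (hi : IntegrableOn (fun z : ℂ => (1 - ‖z‖ ^ 2) ^ ℓ • H z) (Metric.ball 0 1)) :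
    ∫ z in Metric.ball (0 : ℂ) 1, (1 - ‖z‖ ^ 2) ^ ℓ • H z = (Real.pi / (ℓ + 1)) • H 0 := by
  set Φ : ℂ → ℂ := (Metric.ball (0 : ℂ) 1).indicator (fun z => (1 - ‖z‖ ^ 2) ^ ℓ • H z) with hΦ
  have hpi := Real.pi_pos
  have hΦm : Measurable Φ := by
    classical
    have h0 := ContinuousOn.measurable_piecewise (s := Metric.ball (0 : ℂ) 1)
      (f := fun z => (1 - ‖z‖ ^ 2) ^ ℓ • H z) (g := fun _ => (0 : ℂ))
      (ContinuousOn.smul (f := fun z : ℂ => (1 - ‖z‖ ^ 2) ^ ℓ) (by fun_prop) hH.continuousOn)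
      continuousOn_const measurableSet_ball
    exact h0
  have hΦi : Integrable Φ := (integrable_indicator_iff measurableSet_ball).2 hi
  -- Fubini in polar coordinates needs joint integrability, which is the finiteness of the norm
  -- integral of `Φ` rewritten in those coordinates.
  have hpol : IntegrableOn (fun p : ℝ × ℝ => p.1 • Φ (Complex.polarCoord.symm p))
      (Set.Ioi (0 : ℝ) ×ˢ Set.Ioo (-Real.pi) Real.pi) := by
    have hmeas : Measurable (fun p : ℝ × ℝ => p.1 • Φ (Complex.polarCoord.symm p)) := by
      simp only [Complex.polarCoord_symm_apply]
      fun_prop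
    refine ⟨hmeas.aestronglyMeasurable, ?_⟩
    rw [hasFiniteIntegral_iff_enorm, ← polarCoord_target]
    have h1 := hΦi.2
    rw [hasFiniteIntegral_iff_enorm, ← Complex.lintegral_comp_polarCoord_symm] at h1
    refine lt_of_le_of_lt (le_of_eq ?_) h1
    refine setLIntegral_congr_fun polarCoord.open_target.measurableSet fun p hp => ?_
    rw [polarCoord_target] at hp
    simp only [enorm_smul, smul_eq_mul]
    rw [Real.enorm_of_nonneg (le_of_lt hp.1)]
  have hcirc : ∀ r ∈ Set.Ioo (0 : ℝ) 1,
      ∫ θ in Set.Ioo (-Real.pi) Real.pi, H (circleMap 0 r θ) = (2 * Real.pi) • H 0 := by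
    intro r hr
    have hG : DiffContOnCl ℂ H (Metric.ball 0 |r|) := by
      apply DifferentiableOn.diffContOnCl
      rw [abs_of_pos hr.1]
      exact hH.mono
        (Metric.closure_ball_subset_closedBall.trans (Metric.closedBall_subset_ball hr.2))
    have h1 := hG.circleAverage
    rw [Real.circleAverage_eq_integral_add (-Real.pi)] at h1
    have h2 := intervalIntegral.integral_comp_add_right (a := 0) (b := 2 * Real.pi)
      (fun θ => H (circleMap 0 r θ)) (-Real.pi)
    rw [show (0 : ℝ) + -Real.pi = -Real.pi by ring,
      show 2 * Real.pi + -Real.pi = Real.pi by ring] at h2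
    rw [h2] at h1
    rw [← integral_Ioc_eq_integral_Ioo, ← intervalIntegral.integral_of_le (by linarith), ← h1,
      smul_smul, mul_inv_cancel₀ (by positivity), one_smul]
  have hinner : ∀ r ∈ Set.Ioi (0 : ℝ),
      ∫ θ in Set.Ioo (-Real.pi) Real.pi, r • Φ (Complex.polarCoord.symm (r, θ)) =
        (Set.Ioo (0 : ℝ) 1).indicator
          (fun r => (r * (1 - r ^ 2) ^ ℓ) • ((2 * Real.pi) • H 0)) r := by
    intro r hr
    have hr' : 0 < r := hr
    have e0 : ∀ θ : ℝ, Complex.polarCoord.symm (r, θ) = circleMap 0 r θ := by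
      intro θ
      simp [circleMap, Complex.exp_mul_I]
    by_cases h1 : r < 1
    · rw [Set.indicator_of_mem (show r ∈ Set.Ioo (0 : ℝ) 1 from ⟨hr', h1⟩), ← hcirc r ⟨hr, h1⟩,
        ← integral_smul]
      refine integral_congr_ae (Filter.Eventually.of_forall fun θ => ?_)
      have e2 : circleMap 0 r θ ∈ Metric.ball (0 : ℂ) 1 := by
        simp [abs_of_pos hr', h1]
      simp only [e0, hΦ, Set.indicator_of_mem e2, smul_smul]
      simp
    · rw [Set.indicator_of_notMem (fun h => h1 h.2)]
      rw [integral_eq_zero_of_ae]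
      refine Filter.Eventually.of_forall fun θ => ?_
      have e2 : circleMap 0 r θ ∉ Metric.ball (0 : ℂ) 1 := by
        simpa [abs_of_pos hr'] using h1
      simp only [e0, hΦ, Set.indicator_of_notMem e2, smul_zero]
      rfl
  rw [← integral_indicator measurableSet_ball, ← hΦ, ← Complex.integral_comp_polarCoord_symm,
    polarCoord_target, Measure.volume_eq_prod, setIntegral_prod _ hpol,
    setIntegral_congr_fun measurableSet_Ioi hinner, setIntegral_indicator measurableSet_Ioo,
    Set.inter_eq_right.2 Set.Ioo_subset_Ioi_self, integral_smul_const,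
    ← integral_Ioc_eq_integral_Ioo, ← intervalIntegral.integral_of_le zero_le_one,
    integral_mul_one_sub_sq_pow, smul_smul]
  congr 1
  field_simp

/-! ### The Cayley transform -/

theorem det_restrictScalars_toSpanSingleton (c : ℂ) :
    ((ContinuousLinearMap.toSpanSingleton ℂ c).restrictScalars ℝ).det = ‖c‖ ^ 2 := by
  rw [← Complex.normSq_eq_norm_sq]
  simp [ContinuousLinearMap.det, LinearMap.det_restrictScalars, Algebra.norm_complex_apply]

theorem hasFDerivWithinAt_real_of_hasDerivAt {φ : ℂ → ℂ} {c z : ℂ} (h : HasDerivAt φ c z)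
    (s : Set ℂ) :
    HasFDerivWithinAt φ ((ContinuousLinearMap.toSpanSingleton ℂ c).restrictScalars ℝ) s z :=
  (h.hasFDerivAt.restrictScalars ℝ).hasFDerivWithinAt

/-- The Cayley transform of the unit disc onto the right half-plane which sends `0` to `w`. -/
def cayley (w ζ : ℂ) : ℂ := -(starRingEnd ℂ) w + 2 * w.re / (1 - ζ)

theorem one_sub_ne_zero_of_mem_ball {ζ : ℂ} (h : ζ ∈ Metric.ball (0 : ℂ) 1) : 1 - ζ ≠ 0 := by
  intro e
  rw [← sub_eq_zero.1 e] at h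
  simp at h

theorem cayley_zero (w : ℂ) : cayley w 0 = w := by
  apply Complex.ext <;> simp [cayley]
  ring

theorem cayley_re (w : ℂ) {ζ : ℂ} (h : 1 - ζ ≠ 0) :
    (cayley w ζ).re = w.re * (1 - ‖ζ‖ ^ 2) / ‖1 - ζ‖ ^ 2 := by
  have h0 : ‖1 - ζ‖ ^ 2 ≠ 0 := by simpa using h
  rw [← Complex.normSq_eq_norm_sq] at h0 ⊢
  rw [← Complex.normSq_eq_norm_sq]
  have h1 : (cayley w ζ).re = -w.re + 2 * w.re * (1 - ζ.re) / Complex.normSq (1 - ζ) := by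
    rw [cayley, div_eq_mul_inv, Complex.inv_def]
    simp
    ring
  rw [h1]
  field_simp
  simp only [Complex.normSq_apply, Complex.sub_re, Complex.sub_im, Complex.one_re, Complex.one_im]
  ring

theorem hasDerivAt_cayley (w : ℂ) {ζ : ℂ} (h : 1 - ζ ≠ 0) :
    HasDerivAt (cayley w) (2 * w.re / (1 - ζ) ^ 2) ζ := by
  have h1 := (((hasDerivAt_id ζ).const_sub 1).inv h).const_mul (2 * (w.re : ℂ))
  refine (h1.const_add (-(starRingEnd ℂ) w)).congr_deriv ?_
  simp only [id]
  ring

theorem injOn_cayley {w : ℂ} (hw : 0 < w.re) : Set.InjOn (cayley w) (Metric.ball 0 1) := by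
  intro x hx y hy e
  have h1 := one_sub_ne_zero_of_mem_ball hx
  have h2 := one_sub_ne_zero_of_mem_ball hy
  have h3 : (w.re : ℂ) ≠ 0 := by exact_mod_cast hw.ne'
  simp only [cayley, add_right_inj] at e
  field_simp at e
  linear_combination e

theorem cayley_image {w : ℂ} (hw : 0 < w.re) :
    cayley w '' Metric.ball 0 1 = {z : ℂ | 0 < z.re} := by
  ext z
  constructor
  · rintro ⟨ζ, hζ, rfl⟩
    have h1 := one_sub_ne_zero_of_mem_ball hζ
    have h2 : ‖ζ‖ < 1 := by simpa using hζ
    change 0 < (cayley w ζ).re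
    rw [cayley_re w h1]
    have h3 : 0 < ‖1 - ζ‖ := norm_pos_iff.2 h1
    have h4 : 0 < 1 - ‖ζ‖ ^ 2 := by nlinarith [norm_nonneg ζ]
    positivity
  · intro hz
    have hz' : 0 < z.re := hz
    have h1 : z + (starRingEnd ℂ) w ≠ 0 := by
      intro e
      have := congrArg Complex.re e
      simp at this
      linarith
    have h3 : (w.re : ℂ) ≠ 0 := by exact_mod_cast hw.ne'
    refine ⟨1 - 2 * w.re / (z + (starRingEnd ℂ) w), ?_, ?_⟩
    · have e1 : 1 - 2 * w.re / (z + (starRingEnd ℂ) w) = (z - w) / (z + (starRingEnd ℂ) w) := by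
        field_simp
        apply Complex.ext <;> simp <;> ring
      rw [e1, mem_ball_zero_iff, norm_div, div_lt_one (norm_pos_iff.2 h1)]
      apply lt_of_pow_lt_pow_left₀ 2 (norm_nonneg _)
      rw [← Complex.normSq_eq_norm_sq, ← Complex.normSq_eq_norm_sq]
      simp [Complex.normSq_apply]
      nlinarith
    · simp only [cayley, sub_sub_cancel]
      field_simp
      ring

/-- With `z + conj w = 2 Re w / (1 - ζ)`, the Jacobian and the weight together contribute `|1 -
ζ|^(-2(ℓ+2))`, and the conjugated kernel contributes `conj (1 - ζ)^(ℓ+2)`. The antiholomorphic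
factors cancel, as do all powers of `Re w`, leaving a radial weight times a holomorphic factor to
which the mean value property applies. -/
theorem cayley_weight {w : ℂ} (hw : 0 < w.re) {ζ : ℂ} (hζ : ζ ∈ Metric.ball (0 : ℂ) 1)
    (c : ℂ) :
    |((ContinuousLinearMap.toSpanSingleton ℂ (2 * w.re / (1 - ζ) ^ 2)).restrictScalars ℝ).det| •
      ((cayley w ζ).re ^ ℓ • ((starRingEnd ℂ)
        (1 / (cayley w ζ + (starRingEnd ℂ) w) ^ (ℓ + 2)) * c)) =
      ((2 : ℝ) ^ ℓ)⁻¹ • ((1 - ‖ζ‖ ^ 2) ^ ℓ • (c / (1 - ζ) ^ (ℓ + 2))) := by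
  have h1 := one_sub_ne_zero_of_mem_ball hζ
  have h3 : (w.re : ℂ) ≠ 0 := by exact_mod_cast hw.ne'
  have h2 : (starRingEnd ℂ) (1 - ζ) ≠ 0 := (map_ne_zero _).2 h1
  have e1 : cayley w ζ + (starRingEnd ℂ) w = 2 * w.re / (1 - ζ) := by
    simp [cayley]
  have e2 : ((‖1 - ζ‖ ^ 2 : ℝ) : ℂ) = (1 - ζ) * (starRingEnd ℂ) (1 - ζ) := by
    rw [Complex.mul_conj']
    push_cast
    rfl
  have e3 : ‖2 * (w.re : ℂ) / (1 - ζ) ^ 2‖ ^ 2 = (2 * w.re) ^ 2 / (‖1 - ζ‖ ^ 2) ^ 2 := by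
    rw [norm_div, norm_pow, norm_mul, Complex.norm_real]
    simp [div_pow, mul_pow]
  rw [e1, det_restrictScalars_toSpanSingleton, abs_of_nonneg (by positivity), cayley_re w h1, e3]
  simp only [Complex.real_smul, Complex.ofReal_div, Complex.ofReal_pow _ ℓ,
    Complex.ofReal_pow (‖1 - ζ‖ ^ 2) 2, e2, map_div₀, map_pow, map_one, map_mul,
    Complex.conj_ofReal, Complex.ofReal_mul, Complex.conj_ofNat, Complex.ofReal_inv]
  generalize (starRingEnd ℂ) (1 - ζ) = Y at *
  push_cast
  simp only [div_pow, mul_pow]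
  field_simp
  ring

theorem integrable_conj_mul_iff {w : ℂ} (hw : 0 < w.re) (h : ℂ → ℂ) :
    Integrable (fun z : RHP => (starRingEnd ℂ)
        (1 / ((z : ℂ) + (starRingEnd ℂ) w) ^ (ℓ + 2)) * h z) (bergmanMeasure ℓ) ↔
      IntegrableOn (fun ζ : ℂ => (1 - ‖ζ‖ ^ 2) ^ ℓ • (h (cayley w ζ) / (1 - ζ) ^ (ℓ + 2)))
        (Metric.ball 0 1) := by
  rw [integrable_bergmanMeasure_iff (fun z : ℂ => (starRingEnd ℂ)
        (1 / (z + (starRingEnd ℂ) w) ^ (ℓ + 2)) * h z), ← cayley_image hw,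
    integrableOn_image_iff_integrableOn_abs_det_fderiv_smul volume measurableSet_ball
      (fun ζ hζ => hasFDerivWithinAt_real_of_hasDerivAt
        (hasDerivAt_cayley w (one_sub_ne_zero_of_mem_ball hζ)) _) (injOn_cayley hw),
    integrableOn_congr_fun (fun ζ hζ => cayley_weight hw hζ _) measurableSet_ball]
  exact integrable_smul_iff (c := ((2 : ℝ) ^ ℓ)⁻¹) (by positivity) _

theorem integral_conj_mul {w : ℂ} (hw : 0 < w.re) (h : ℂ → ℂ) :
    ∫ z : RHP, (starRingEnd ℂ)
        (1 / ((z : ℂ) + (starRingEnd ℂ) w) ^ (ℓ + 2)) * h z ∂(bergmanMeasure ℓ) =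
      Real.pi⁻¹ • ((2 : ℝ) ^ ℓ)⁻¹ • ∫ ζ in Metric.ball (0 : ℂ) 1,
        (1 - ‖ζ‖ ^ 2) ^ ℓ • (h (cayley w ζ) / (1 - ζ) ^ (ℓ + 2)) := by
  rw [integral_bergmanMeasure (fun z : ℂ => (starRingEnd ℂ)
        (1 / (z + (starRingEnd ℂ) w) ^ (ℓ + 2)) * h z), ← cayley_image hw,
    integral_image_eq_integral_abs_det_fderiv_smul volume measurableSet_ball
      (fun ζ hζ => hasFDerivWithinAt_real_of_hasDerivAt
        (hasDerivAt_cayley w (one_sub_ne_zero_of_mem_ball hζ)) _) (injOn_cayley hw),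
    setIntegral_congr_fun measurableSet_ball (fun ζ hζ => cayley_weight hw hζ _),
    integral_smul]

/-! ### The reproducing kernel -/

theorem add_conj_ne_zero (z w : RHP) : (z : ℂ) + (starRingEnd ℂ) (w : ℂ) ≠ 0 := by
  intro e
  have h1 := congrArg Complex.re e
  simp only [Complex.add_re, Complex.conj_re, Complex.zero_re] at h1
  linarith [z.2, w.2]

theorem isAnalytic_kernel (c : ℂ) (w : RHP) (n : ℕ) :
    IsAnalytic fun z => c / ((z : ℂ) + (starRingEnd ℂ) (w : ℂ)) ^ n := by
  refine ⟨fun z => c / (z + (starRingEnd ℂ) (w : ℂ)) ^ n, fun z hz => ?_, fun z => rfl⟩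
  have := add_conj_ne_zero ⟨z, hz⟩ w
  have h1 : DifferentiableAt ℂ (fun z => (z + (starRingEnd ℂ) (w : ℂ)) ^ n) z := by fun_prop
  exact ((differentiableAt_const c).div h1 (pow_ne_zero n this)).differentiableWithinAt

theorem memLp_kernel (ℓ : ℕ) (c : ℂ) (w : RHP) :
    MemLp (fun z : RHP => c / ((z : ℂ) + (starRingEnd ℂ) (w : ℂ)) ^ (ℓ + 2)) 2
      (bergmanMeasure ℓ) := by
  have key : MemLp (fun z : RHP => 1 / ((z : ℂ) + (starRingEnd ℂ) (w : ℂ)) ^ (ℓ + 2)) 2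
      (bergmanMeasure ℓ) := by
    rw [memLp_two_iff_integrable_sq_norm
      (isAnalytic_kernel 1 w (ℓ + 2)).continuous.aestronglyMeasurable]
    have h1 := (integrable_conj_mul_iff (ℓ := ℓ) w.2
      (fun z => 1 / (z + (starRingEnd ℂ) (w : ℂ)) ^ (ℓ + 2))).2 ?_
    · refine h1.norm.congr (Filter.Eventually.of_forall fun z => ?_)
      simp only
      rw [norm_mul, RCLike.norm_conj, sq]
    · have h3 : ((w : ℂ).re : ℂ) ≠ 0 := by exact_mod_cast w.2.ne'
      -- Paired with itself, the kernel pulls back to a constant times the radial weight, because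
      -- its powers of `1 - ζ` cancel.
      have h2 : IntegrableOn (fun ζ : ℂ => (1 - ‖ζ‖ ^ 2) ^ ℓ •
          (1 / (2 * ((w : ℂ).re : ℂ)) ^ (ℓ + 2))) (Metric.ball 0 1) := by
        refine IntegrableOn.mono_set (t := Metric.closedBall 0 1) ?_ Metric.ball_subset_closedBall
        exact ContinuousOn.integrableOn_compact (isCompact_closedBall _ _) (by fun_prop)
      refine (integrableOn_congr_fun (fun ζ hζ => ?_) measurableSet_ball).1 h2
      have h1 := one_sub_ne_zero_of_mem_ball hζ
      congr 1
      rw [show cayley w ζ + (starRingEnd ℂ) (w : ℂ) = 2 * ((w : ℂ).re : ℂ) / (1 - ζ) by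
        simp [cayley], div_pow]
      field_simp
  convert key.const_mul c using 2 with z
  ring

/-- The normalisation constant of the reproducing kernel. -/
def kernelConst (ℓ : ℕ) : ℝ := 2 ^ ℓ * (ℓ + 1)

theorem kernelConst_ne_zero (ℓ : ℕ) : (kernelConst ℓ : ℂ) ≠ 0 := by
  have : kernelConst ℓ ≠ 0 := by
    unfold kernelConst
    positivity
  exact_mod_cast this

/-- The reproducing kernel of the Bergman space of the right half-plane. -/
def kernel (ℓ : ℕ) (w : RHP) : Bergman ℓ :=
  ⟨fun z => kernelConst ℓ / ((z : ℂ) + (starRingEnd ℂ) (w : ℂ)) ^ (ℓ + 2),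
    isAnalytic_kernel _ w _, memLp_kernel ℓ _ w⟩

theorem kernel_apply (w z : RHP) :
    kernel ℓ w z = kernelConst ℓ / ((z : ℂ) + (starRingEnd ℂ) (w : ℂ)) ^ (ℓ + 2) := rfl

/-- On the disc the pairing is the radial mean of `h (cayley w ζ) / (1 - ζ)^(ℓ+2)`, whose value at
`ζ = 0` is `h w`. The remaining factor `π⁻¹ · 2^(-ℓ) · π / (ℓ+1)` is what `kernelConst` normalises
away. -/
theorem inner_kernel (w : RHP) (h : Bergman ℓ) : inner ℂ (kernel ℓ w) h = h w := by
  obtain ⟨H, hH, hH'⟩ := h.mem.1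
  have hc := kernelConst_ne_zero ℓ
  have e1 : ∀ z : RHP, (starRingEnd ℂ) (1 / ((z : ℂ) + (starRingEnd ℂ) (w : ℂ)) ^ (ℓ + 2)) * H z =
      (kernelConst ℓ : ℂ)⁻¹ * ((starRingEnd ℂ) (kernel ℓ w z) * h z) := by
    intro z
    rw [kernel_apply, hH', ← mul_assoc]
    congr 1
    simp only [map_div₀, Complex.conj_ofReal, map_one]
    field_simp
  have hint : IntegrableOn (fun ζ : ℂ => (1 - ‖ζ‖ ^ 2) ^ ℓ •
      (H (cayley w ζ) / (1 - ζ) ^ (ℓ + 2))) (Metric.ball 0 1) := by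
    rw [← integrable_conj_mul_iff w.2]
    simp_rw [e1]
    exact ((kernel ℓ w).integrable_inner h).const_mul _
  have hdiff : DifferentiableOn ℂ (fun ζ => H (cayley w ζ) / (1 - ζ) ^ (ℓ + 2))
      (Metric.ball 0 1) := by
    intro ζ hζ
    have h1 := one_sub_ne_zero_of_mem_ball hζ
    have h2 : DifferentiableAt ℂ H (cayley w ζ) := by
      refine hH.differentiableAt (isOpen_halfPlane.mem_nhds ?_)
      rw [← cayley_image w.2]
      exact Set.mem_image_of_mem _ hζ
    have h3 : DifferentiableAt ℂ (fun ζ : ℂ => (1 - ζ) ^ (ℓ + 2)) ζ := by fun_prop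
    exact ((h2.comp ζ (hasDerivAt_cayley w h1).differentiableAt).div h3
      (pow_ne_zero _ h1)).differentiableWithinAt
  have h3 := integral_conj_mul (ℓ := ℓ) w.2 H
  simp_rw [e1] at h3
  rw [integral_const_mul, ← Bergman.inner_def, integral_ball_radial_smul hdiff hint,
    cayley_zero, hH', inv_mul_eq_iff_eq_mul₀ hc] at h3
  rw [h3]
  have hpi : (Real.pi : ℂ) ≠ 0 := by exact_mod_cast Real.pi_ne_zero
  have hl : (ℓ : ℂ) + 1 ≠ 0 := by exact_mod_cast Nat.succ_ne_zero ℓ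
  simp [kernelConst]
  field_simp

/-! ### Selfadjointness tested on kernels -/

theorem reflect_reflect (a : ℝ) (z : RHP) : reflect a (reflect a z) = z := by
  apply Subtype.ext
  simp [reflect]

theorem conj_reflect (a : ℝ) (z : RHP) :
    (starRingEnd ℂ) (reflect a z : ℂ) = z - Complex.I * a := by
  simp [reflect, sub_eq_add_neg]

theorem conjugation_kernel (a : ℝ) (w : RHP) :
    conjugation ℓ a (kernel ℓ w) = kernel ℓ (reflect a w) := by
  apply DFunLike.coe_injective
  funext z
  rw [conjugation_apply, kernel_apply, kernel_apply, map_div₀, map_pow, map_add, conj_reflect,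
    conj_reflect, Complex.conj_conj, Complex.conj_ofReal]
  congr 2
  ring

/-- The symmetry relation between the symbols `f` and `g` which expresses `C_a`-selfadjointness
on reproducing kernels. -/
def SymbolSymm (ℓ : ℕ) (a : ℝ) (f : RHP → ℂ) (g : RHP → RHP) : Prop :=
  ∀ z u : RHP, f z * ((z : ℂ) + g u - Complex.I * a) ^ (ℓ + 2) =
    f u * ((u : ℂ) + g z - Complex.I * a) ^ (ℓ + 2)

theorem add_sub_I_mul_ne_zero (a : ℝ) (z w : RHP) : (z : ℂ) + w - Complex.I * a ≠ 0 := by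
  intro e
  have h1 := congrArg Complex.re e
  simp at h1
  linarith [z.2, w.2]

variable {a : ℝ} {f : RHP → ℂ} {g : RHP → RHP}

/-- Both sides equal `f w * x (g w)`. This puts every kernel in the domain of the adjoint and
computes the adjoint there, without any boundedness. -/
theorem inner_adjoint_kernel (w : RHP) (x : (wcompMax ℓ f g).domain) :
    inner ℂ ((starRingEnd ℂ) (f w) • kernel ℓ (g w)) (x : Bergman ℓ) =
      inner ℂ (kernel ℓ w) (wcompMax ℓ f g x) := by
  rw [inner_smul_left, inner_kernel, inner_kernel, Complex.conj_conj]
  rfl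

/-- Equality of domains is used here: it puts `kernel ℓ (reflect a w)` in the domain of the operator
itself. Its image, computed directly and through the adjoint, gives the relation. -/
theorem symbolSymm_of_isCSelfadjoint
    (h : IsCSelfadjoint (conjugation ℓ a) (wcompMax ℓ f g)) : SymbolSymm ℓ a f g := by
  obtain ⟨hd, hT⟩ := h
  intro z w
  have hw : kernel ℓ w ∈ (wcompMax ℓ f g).adjoint.domain :=
    LinearPMap.mem_adjoint_domain_of_exists _ ⟨_, inner_adjoint_kernel w⟩
  have hadj : (wcompMax ℓ f g).adjoint ⟨kernel ℓ w, hw⟩ =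
      (starRingEnd ℂ) (f w) • kernel ℓ (g w) :=
    LinearPMap.adjoint_apply_eq hd _ (inner_adjoint_kernel w)
  have hconj : conjugation ℓ a (kernel ℓ (reflect a w)) = kernel ℓ w := by
    rw [conjugation_kernel, reflect_reflect]
  have hu' : kernel ℓ (reflect a w) ∈
      (sandwich (conjugation ℓ a) (wcompMax ℓ f g).adjoint).domain := by
    change conjugation ℓ a (kernel ℓ (reflect a w)) ∈ (wcompMax ℓ f g).adjoint.domain
    rwa [hconj]
  have hu : kernel ℓ (reflect a w) ∈ (wcompMax ℓ f g).domain := by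
    rw [hT]
    exact hu'
  have e1 : wcompMax ℓ f g ⟨_, hu⟩ =
      sandwich (conjugation ℓ a) (wcompMax ℓ f g).adjoint ⟨_, hu'⟩ := hT.le.2 rfl
  have e2 : sandwich (conjugation ℓ a) (wcompMax ℓ f g).adjoint ⟨_, hu'⟩ =
      f w • kernel ℓ (reflect a (g w)) := by
    have : sandwich (conjugation ℓ a) (wcompMax ℓ f g).adjoint ⟨_, hu'⟩ =
        conjugation ℓ a ((wcompMax ℓ f g).adjoint ⟨kernel ℓ w, hw⟩) := by
      change conjugation ℓ a ((wcompMax ℓ f g).adjoint ⟨_, _⟩) = _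
      congr 2
      exact Subtype.ext hconj
    rw [this, hadj, map_smulₛₗ, conjugation_kernel, Complex.conj_conj]
  have e3 : f z * kernel ℓ (reflect a w) (g z) = f w * kernel ℓ (reflect a (g w)) z :=
    congrArg (fun k : Bergman ℓ => k z) (e1.trans e2)
  rw [kernel_apply, kernel_apply, conj_reflect, conj_reflect] at e3
  have hc := kernelConst_ne_zero ℓ
  have h1 := add_sub_I_mul_ne_zero a (g z) w
  have h2 := add_sub_I_mul_ne_zero a z (g w)
  rw [← add_sub_assoc, ← add_sub_assoc] at e3
  rw [add_comm (w : ℂ)]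
  field_simp at e3
  rw [e3, mul_comm]

/-- Boundedness makes the adjoint everywhere defined, so only values are to be compared. Pairing
with a kernel moves the adjoint back onto that kernel, where the relation identifies the image as a
multiple of another kernel. -/
theorem isCSelfadjoint_of_symbolSymm (hb : IsBoundedOp (wcompMax ℓ f g))
    (hs : SymbolSymm ℓ a f g) : IsCSelfadjoint (conjugation ℓ a) (wcompMax ℓ f g) := by
  obtain ⟨hdom, L, hL, hbound⟩ := hb
  have hmem : ∀ h : Bergman ℓ, h ∈ (wcompMax ℓ f g).domain := fun h => by
    rw [hdom]
    trivial
  have hd : Dense ((wcompMax ℓ f g).domain : Set (Bergman ℓ)) := by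
    rw [hdom]
    exact dense_univ
  have hadj : ∀ h : Bergman ℓ, h ∈ (wcompMax ℓ f g).adjoint.domain := by
    intro h
    rw [LinearPMap.mem_adjoint_domain_iff]
    have hc : Continuous (wcompMax ℓ f g).toFun :=
      AddMonoidHomClass.continuous_of_bound _ L hbound
    exact (innerSL ℂ h).continuous.comp hc
  refine ⟨hd, LinearPMap.ext (Submodule.ext fun h => ⟨fun _ => hadj _, fun _ => hmem h⟩) ?_⟩
  intro h h1 h2
  apply DFunLike.coe_injective
  funext z
  change f z * h (g z) = (starRingEnd ℂ) ((wcompMax ℓ f g).adjoint ⟨conjugation ℓ a h, _⟩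
    (reflect a z))
  rw [← inner_kernel (reflect a z), inner_conj_symm,
    LinearPMap.adjoint_isFormalAdjoint hd _ ⟨kernel ℓ (reflect a z), hmem _⟩]
  have e1 : wcompMax ℓ f g ⟨kernel ℓ (reflect a z), hmem _⟩ =
      f z • kernel ℓ (reflect a (g z)) := by
    apply DFunLike.coe_injective
    funext u
    change f u * kernel ℓ (reflect a z) (g u) = f z * kernel ℓ (reflect a (g z)) u
    rw [kernel_apply, kernel_apply, conj_reflect, conj_reflect]
    have h1 := add_sub_I_mul_ne_zero a (g u) z
    have h2 := add_sub_I_mul_ne_zero a u (g z)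
    rw [← add_sub_assoc, ← add_sub_assoc]
    have := hs u z
    rw [add_comm (z : ℂ)] at this
    field_simp
    linear_combination (kernelConst ℓ : ℂ) * this
  rw [e1, inner_smul_right, ← inner_conj_symm, inner_kernel, conjugation_apply, reflect_reflect,
    Complex.conj_conj]

/-! ### Criteria for boundedness -/

theorem isBoundedOp_of_le {L : ℝ} (hL : 0 ≤ L)
    (h : ∀ h : Bergman ℓ, ∃ k : Bergman ℓ, (∀ z, k z = f z * h (g z)) ∧ ‖k‖ ≤ L * ‖h‖) :
    IsBoundedOp (wcompMax ℓ f g) := by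
  have key : ∀ h : Bergman ℓ, (fun z => f z * h (g z)) ∈ bergmanSubmodule ℓ := by
    intro x
    obtain ⟨k, hk, -⟩ := h x
    rw [← funext hk]
    exact k.mem
  -- `L` may be zero, while `IsBoundedOp` asks for a strictly positive bound.
  refine ⟨Submodule.eq_top_iff'.2 key, L + 1, by linarith, fun x => ?_⟩
  obtain ⟨k, hk, hk'⟩ := h x
  have : wcompMax ℓ f g x = k := by
    apply DFunLike.coe_injective
    funext z
    exact (hk z).symm
  rw [this]
  refine hk'.trans ?_
  gcongr
  linarith

/-- A weighted composition operator with constant inner symbol whose outer symbol lies in the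
Bergman space is bounded. -/
theorem isBoundedOp_of_const (k : Bergman ℓ) (hk : ∀ z, k z = f z) {w : RHP} (hg : ∀ z, g z = w) :
    IsBoundedOp (wcompMax ℓ f g) := by
  refine isBoundedOp_of_le (L := ‖kernel ℓ w‖ * ‖k‖) (by positivity) fun h => ⟨h w • k, ?_, ?_⟩
  · intro z
    rw [Bergman.smul_apply, hk, hg, mul_comm]
  · rw [norm_smul, ← inner_kernel w h]
    calc _ ≤ (‖kernel ℓ w‖ * ‖h‖) * ‖k‖ := by
          gcongr
          exact norm_inner_le_norm _ _
      _ = _ := by ring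

theorem isBoundedOp_of_forall_eq_zero (hf : ∀ z, f z = 0) : IsBoundedOp (wcompMax ℓ f g) :=
  isBoundedOp_of_le le_rfl fun h => ⟨0, by simp [hf], by simp⟩

/-- If `g` extends to an injective holomorphic function `G`, `|f|² ≤ C |G'|^(ℓ+2)` and
the Schwarz–Pick inequality `Re z |G'(z)| ≤ Re G(z)` holds, then the weighted composition operator
is bounded. -/
theorem isBoundedOp_of_injOn (hf : IsAnalytic f) {G G' : ℂ → ℂ} {C : ℝ} (hC : 0 ≤ C)
    (hG : ∀ z : RHP, (g z : ℂ) = G z) (hGd : ∀ z : ℂ, 0 < z.re → HasDerivAt G (G' z) z)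
    (hinj : Set.InjOn G {z : ℂ | 0 < z.re})
    (hfG : ∀ z : RHP, ‖f z‖ ^ 2 ≤ C * ‖G' z‖ ^ (ℓ + 2))
    (hSP : ∀ z : RHP, (z : ℂ).re * ‖G' z‖ ≤ (G z).re) :
    IsBoundedOp (wcompMax ℓ f g) := by
  have han : ∀ h : Bergman ℓ, IsAnalytic (fun z => f z * h (g z)) := by
    intro h
    obtain ⟨F, hF, hF'⟩ := hf
    obtain ⟨H, hH, hH'⟩ := h.mem.1
    refine ⟨fun z => F z * H (G z), ?_, fun z => by simp only [hF', ← hG, hH']⟩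
    refine hF.mul (hH.comp (fun z hz => (hGd z hz).differentiableAt.differentiableWithinAt) ?_)
    intro z hz
    have := (g ⟨z, hz⟩).2
    rwa [hG] at this
  have hle : ∀ h : Bergman ℓ, ∫⁻ z, ‖f z * h (g z)‖ₑ ^ 2 ∂(bergmanMeasure ℓ) ≤
      ENNReal.ofReal C * ‖h‖ₑ ^ 2 := by
    intro h
    obtain ⟨F, hF, hF'⟩ := hf
    obtain ⟨H, hH, hH'⟩ := h.mem.1
    have e1 : ∀ z : RHP, ‖f z * h (g z)‖ₑ ^ 2 = ‖F z * H (G z)‖ₑ ^ 2 := by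
      intro z
      rw [hF', ← hG, hH']
    have m1 : Measurable fun z : RHP => ‖F z * H (G z)‖ₑ ^ 2 := by
      simp_rw [← e1]
      have := (han h).continuous.measurable
      fun_prop
    have m2 : Measurable fun z : RHP => ‖H z‖ₑ ^ 2 := by
      simp_rw [hH']
      have := h.mem.1.continuous.measurable
      fun_prop
    have e2 : ∀ z : RHP, ‖h z‖ₑ ^ 2 = ‖H z‖ₑ ^ 2 := fun z => by rw [hH']
    rw [h.enorm_sq]
    simp_rw [e1, e2]
    rw [lintegral_bergmanMeasure (fun z => ‖F z * H (G z)‖ₑ ^ 2) m1,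
      lintegral_bergmanMeasure (fun z => ‖H z‖ₑ ^ 2) m2, mul_left_comm]
    gcongr
    have hsub : G '' {z : ℂ | 0 < z.re} ⊆ {z : ℂ | 0 < z.re} := by
      rintro _ ⟨z, hz, rfl⟩
      have := (g ⟨z, hz⟩).2
      rwa [hG] at this
    calc ∫⁻ z in {z : ℂ | 0 < z.re}, ENNReal.ofReal (z.re ^ ℓ) * ‖F z * H (G z)‖ₑ ^ 2
        ≤ ∫⁻ z in {z : ℂ | 0 < z.re}, ENNReal.ofReal C *
          (ENNReal.ofReal |((ContinuousLinearMap.toSpanSingleton ℂ (G' z)).restrictScalars ℝ).det| *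
            (ENNReal.ofReal ((G z).re ^ ℓ) * ‖H (G z)‖ₑ ^ 2)) := by
          refine setLIntegral_mono' measurableSet_halfPlane fun z hz => ?_
          have hz' : 0 < z.re := hz
          have hGz : 0 < (G z).re := hsub (Set.mem_image_of_mem _ hz)
          rw [det_restrictScalars_toSpanSingleton, abs_of_nonneg (by positivity)]
          simp only [← ofReal_norm, ← ENNReal.ofReal_pow (norm_nonneg _)]
          rw [← ENNReal.ofReal_mul (by positivity), ← ENNReal.ofReal_mul (by positivity),
            ← ENNReal.ofReal_mul (by positivity), ← ENNReal.ofReal_mul (by positivity)]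
          apply ENNReal.ofReal_le_ofReal
          rw [norm_mul, mul_pow, hF' ⟨z, hz⟩]
          -- Of the `ℓ + 2` factors `‖G'‖`, two form the Jacobian and `ℓ` turn the weight at `z`
          -- into at most the weight at `G z`, by Schwarz–Pick.
          calc z.re ^ ℓ * (‖f ⟨z, hz⟩‖ ^ 2 * ‖H (G z)‖ ^ 2)
              ≤ z.re ^ ℓ * ((C * ‖G' z‖ ^ (ℓ + 2)) * ‖H (G z)‖ ^ 2) := by
                gcongr
                exact hfG ⟨z, hz⟩
            _ = C * (‖G' z‖ ^ 2 * ((z.re * ‖G' z‖) ^ ℓ * ‖H (G z)‖ ^ 2)) := by ring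
            _ ≤ _ := by
                gcongr
                exact hSP ⟨z, hz⟩
      _ = ENNReal.ofReal C * ∫⁻ z in G '' {z : ℂ | 0 < z.re},
            ENNReal.ofReal (z.re ^ ℓ) * ‖H z‖ₑ ^ 2 := by
          rw [lintegral_const_mul' _ _ ENNReal.ofReal_ne_top,
            lintegral_image_eq_lintegral_abs_det_fderiv_mul volume measurableSet_halfPlane
            (fun z hz => hasFDerivWithinAt_real_of_hasDerivAt (hGd z hz) _) hinj]
      _ ≤ _ := by
          gcongr
  refine isBoundedOp_of_le (L := Real.sqrt C) (Real.sqrt_nonneg _) fun h => ?_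
  have hmem : MemLp (fun z => f z * h (g z)) 2 (bergmanMeasure ℓ) := by
    refine ⟨(han h).continuous.aestronglyMeasurable, ?_⟩
    have e := eLpNorm_nnreal_pow_eq_lintegral (f := fun z => f z * h (g z))
      (μ := bergmanMeasure ℓ) (p := 2) (by norm_num)
    norm_num at e
    have h1 : eLpNorm (fun z => f z * h (g z)) 2 (bergmanMeasure ℓ) ^ 2 < ⊤ := by
      rw [e]
      refine lt_of_le_of_lt (by simpa using hle h) ?_
      exact ENNReal.mul_lt_top ENNReal.ofReal_lt_top (ENNReal.pow_lt_top enorm_lt_top)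
    exact (ENNReal.pow_lt_top_iff.1 h1).resolve_right (by norm_num)
  obtain ⟨k, hk⟩ : ∃ k : Bergman ℓ, ∀ z, k z = f z * h (g z) :=
    ⟨⟨fun z => f z * h (g z), han h, hmem⟩, fun z => rfl⟩
  refine ⟨k, hk, ?_⟩
  have h3 := hle h
  simp_rw [← hk] at h3
  rw [← k.enorm_sq, ← ofReal_norm, ← ofReal_norm, ← ENNReal.ofReal_pow (norm_nonneg _),
    ← ENNReal.ofReal_pow (norm_nonneg _), ← ENNReal.ofReal_mul hC,
    ENNReal.ofReal_le_ofReal_iff (by positivity)] at h3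
  apply le_of_sq_le_sq _ (by positivity)
  rw [mul_pow, Real.sq_sqrt hC]
  exact h3

/-! ### Eliminating the outer symbol -/

instance : PreconnectedSpace RHP :=
  isPreconnected_iff_preconnectedSpace.1 (convex_halfSpace_re_gt 0).isPreconnected

/-- The roots of unity of order `n` form a finite, hence discrete, set, so a continuous map from a
connected space into it is constant. -/
theorem eq_one_of_pow_eq_one {X : Type*} [TopologicalSpace X] [PreconnectedSpace X]
    {Q : X → ℂ} (hQ : Continuous Q) {n : ℕ} (hn : n ≠ 0) (h : ∀ x, Q x ^ n = 1) {x₀ : X}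
    (h₀ : Q x₀ = 1) (x : X) : Q x = 1 := by
  have hfin : {z : ℂ | z ^ n = 1}.Finite := by
    refine ((Polynomial.nthRoots n (1 : ℂ)).toFinset.finite_toSet).subset fun z hz => ?_
    simpa [Polynomial.mem_nthRoots (Nat.pos_of_ne_zero hn)] using hz
  rw [← h₀]
  exact isPreconnected_univ.constant_of_mapsTo (T := {z : ℂ | z ^ n = 1}) hfin.isDiscrete
    hQ.continuousOn
    (fun y _ => h y) (Set.mem_univ x) (Set.mem_univ x₀)

theorem SymbolSymm.ne_zero (hs : SymbolSymm ℓ a f g) {z₀ : RHP} (h₀ : f z₀ ≠ 0) (z : RHP) :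
    f z ≠ 0 := by
  intro h
  have h1 := hs z₀ z
  rw [h, zero_mul] at h1
  exact mul_ne_zero h₀ (pow_ne_zero _ (add_sub_I_mul_ne_zero a z₀ (g z))) h1

/-- Extracting `(ℓ+2)`-th roots in the symmetry relation eliminates `f`. -/
theorem SymbolSymm.cross_identity (hs : SymbolSymm ℓ a f g) (hg : Continuous g) {b : RHP}
    (h₀ : f b ≠ 0) (z u : RHP) :
    ((b : ℂ) + g z - Complex.I * a) * (z + g u - Complex.I * a) * (u + g b - Complex.I * a) =
      ((b : ℂ) + g u - Complex.I * a) * (u + g z - Complex.I * a) * (z + g b - Complex.I * a) := by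
  have hne := fun z w : RHP => add_sub_I_mul_ne_zero a z w
  set P : RHP → RHP → ℂ := fun z u => (z : ℂ) + g u - Complex.I * a with hP
  have hP0 : ∀ z u, P z u ≠ 0 := fun z u => hne z (g u)
  set Q : RHP × RHP → ℂ := fun p =>
    (P b p.1 * P p.1 p.2 * P p.2 b) / (P b p.2 * P p.2 p.1 * P p.1 b) with hQ
  have hQc : Continuous Q := by
    refine Continuous.div (by fun_prop) (by fun_prop) fun p => ?_
    exact mul_ne_zero (mul_ne_zero (hP0 _ _) (hP0 _ _)) (hP0 _ _)
  have hQ1 : ∀ p, Q p ^ (ℓ + 2) = 1 := by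
    rintro ⟨z, u⟩
    have e1 : f z * P z b ^ (ℓ + 2) = f b * P b z ^ (ℓ + 2) := hs z b
    have e2 : f u * P u b ^ (ℓ + 2) = f b * P b u ^ (ℓ + 2) := hs u b
    have e3 : f z * P z u ^ (ℓ + 2) = f u * P u z ^ (ℓ + 2) := hs z u
    have hz := hs.ne_zero h₀ z
    have hu := hs.ne_zero h₀ u
    simp only [hQ]
    rw [div_pow, div_eq_one_iff_eq (pow_ne_zero _
      (mul_ne_zero (mul_ne_zero (hP0 _ _) (hP0 _ _)) (hP0 _ _)))]
    simp only [mul_pow]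
    -- After multiplication by `f b * f z * f u`, the relations for the pairs `(z, b)`, `(u, b)` and
    -- `(z, u)` carry one side into the other.
    apply mul_left_cancel₀ (mul_ne_zero h₀ (mul_ne_zero hz hu))
    linear_combination (-(f z * f u) * P z u ^ (ℓ + 2) * P u b ^ (ℓ + 2)) * e1
      + (f z * f u * P u z ^ (ℓ + 2) * P z b ^ (ℓ + 2)) * e2
      + (f z * f u * P z b ^ (ℓ + 2) * P u b ^ (ℓ + 2)) * e3
  have hQb : Q (b, b) = 1 := div_self (mul_ne_zero (mul_ne_zero (hP0 _ _) (hP0 _ _)) (hP0 _ _))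
  have h1 := eq_one_of_pow_eq_one hQc (by omega) hQ1 hQb (z, u)
  simp only [hQ] at h1
  rwa [div_eq_one_iff_eq (mul_ne_zero (mul_ne_zero (hP0 _ _) (hP0 _ _)) (hP0 _ _))] at h1

/-- The inner symbol satisfies a symmetric bilinear (Möbius) equation. -/
theorem SymbolSymm.exists_bilinear (hs : SymbolSymm ℓ a f g) (hg : Continuous g) {b : RHP}
    (h₀ : f b ≠ 0) : ∃ A B D : ℂ, (A ≠ 0 ∨ B ≠ 0) ∧ ∀ z : RHP,
      A * ((z : ℂ) - Complex.I * a) * g z + B * (g z - (z - Complex.I * a)) = D := by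
  have hb := b.2
  -- With `A` and `B` the coefficients chosen below, `B + (u - ia) A = (u - b) (u + g b - ia)`. Any
  -- `u ≠ b` thus prevents both from vanishing; the choice `b + 1` makes the first factor `1`.
  let u : RHP := ⟨b + 1, by simp; linarith⟩
  have hu : (u : ℂ) = b + 1 := rfl
  refine ⟨u + g b - b - g u, g u * (u - Complex.I * a) - g b * (b - Complex.I * a),
    (u - Complex.I * a) * g b * (b - Complex.I * a) + (u - Complex.I * a) * g b * g u
      - (b - Complex.I * a) * g u * (u - Complex.I * a) - (b - Complex.I * a) * g u * g b, ?_, ?_⟩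
  · by_contra! h
    obtain ⟨h1, h2⟩ := h
    apply add_sub_I_mul_ne_zero a u (g b)
    linear_combination h2 + (u - Complex.I * a) * h1 - (u + g b - Complex.I * a) * hu
  · intro z
    linear_combination hs.cross_identity hg h₀ z u

/-! ### Möbius self-maps of the half-plane -/

/-- Put `v = x + b`; the hypothesis says `Re (e / v) < Re b` whenever `Re v > Re b`. If `Re b = 0`,
then `1 / v` fills a half-plane, which forces `e` to be real and negative. If `Re b > 0`, then `1 /
v` fills the open disc with centre and radius `1 / (2 Re b)`, over which the supremum of `Re (e /
v)` is `(Re e + |e|) / (2 Re b)`. A negative `Re b` would give a pole in the half-plane. -/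
theorem re_conditions_of_forall_pos {b e : ℂ} (he : e ≠ 0)
    (h : ∀ x : ℂ, 0 < x.re → x + b ≠ 0 ∧ 0 < (b - e / (x + b)).re) :
    (b.re = 0 ∧ e.im = 0 ∧ e.re < 0) ∨ (0 < b.re ∧ e.re + ‖e‖ ≤ 2 * b.re ^ 2) := by
  have hb : 0 ≤ b.re := by
    by_contra! hb
    exact (h (-b) (by simpa using hb)).1 (by ring)
  rcases hb.eq_or_lt with hb | hb
  · left
    have key : ∀ t : ℝ, e.re < t * e.im := by
      intro t
      have hq : (1 + t * Complex.I : ℂ) ≠ 0 := by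
        intro e
        simpa using congrArg Complex.re e
      have hx : 0 < (1 / (1 + t * Complex.I) - b : ℂ).re := by
        rw [Complex.sub_re, ← hb, sub_zero, one_div, Complex.inv_re]
        have := Complex.normSq_pos.2 hq
        simpa using this
      have h1 := (h _ hx).2
      rw [sub_add_cancel, div_div_eq_mul_div, div_one] at h1
      simp [← hb] at h1
      linarith
    refine ⟨hb.symm, ?_, by simpa using key 0⟩
    by_contra hi
    have := key (e.re / e.im)
    rw [div_mul_cancel₀ _ hi] at this
    exact lt_irrefl _ this
  · right
    refine ⟨hb, ?_⟩
    by_contra! hlt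
    have hn : 0 < ‖e‖ := norm_pos_iff.2 he
    have hre : -‖e‖ ≤ -e.re := neg_le_neg (Complex.re_le_norm e)
    -- Chosen so that `Re e + s |e| = 2 (Re b)²`. If the inequality failed, then `|s| < 1`, and the
    -- point with `1 / v = q / (2 Re b)`, where `q = 1 + s conj e / |e|`, would be admissible and
    -- give `Re (e / v) = Re b`.
    set s : ℝ := (2 * b.re ^ 2 - e.re) / ‖e‖ with hs
    have hsn : s * ‖e‖ = 2 * b.re ^ 2 - e.re := div_mul_cancel₀ _ hn.ne'
    have hs1 : s < 1 := by
      rw [hs, div_lt_one hn]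
      linarith
    have hs2 : -1 < s := by
      rw [hs, lt_div_iff₀ hn]
      have := pow_pos hb 2
      linarith
    set q : ℂ := 1 + s * (starRingEnd ℂ) e / ‖e‖ with hq
    have hnc : (‖e‖ : ℂ) ≠ 0 := by exact_mod_cast hn.ne'
    have hqr : q.re = 1 + s * e.re / ‖e‖ := by
      have : q = 1 + ((s / ‖e‖ : ℝ) : ℂ) * (starRingEnd ℂ) e := by
        rw [hq]
        push_cast
        ring
      rw [this, Complex.add_re, Complex.re_ofReal_mul, Complex.one_re, Complex.conj_re]
      ring
    have hqi : q.im = -(s * e.im / ‖e‖) := by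
      have : q = 1 + ((s / ‖e‖ : ℝ) : ℂ) * (starRingEnd ℂ) e := by
        rw [hq]
        push_cast
        ring
      rw [this, Complex.add_im, Complex.im_ofReal_mul, Complex.one_im, Complex.conj_im]
      ring
    have hee : e.re ^ 2 + e.im ^ 2 = ‖e‖ ^ 2 := by
      rw [← Complex.normSq_eq_norm_sq, Complex.normSq_apply]
      ring
    have hqn : Complex.normSq q = 2 * q.re - 1 + s ^ 2 := by
      rw [Complex.normSq_apply, hqr, hqi]
      field_simp
      linear_combination s ^ 2 * hee
    have hs3 : s ^ 2 < 1 := by nlinarith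
    have hq0 : q ≠ 0 := by
      intro h0
      rw [h0] at hqn
      simp at hqn
      linarith
    have hqp := Complex.normSq_pos.2 hq0
    have hbc : (b.re : ℂ) ≠ 0 := by exact_mod_cast hb.ne'
    have hx : 0 < (2 * b.re / q - b : ℂ).re := by
      have : (2 * b.re / q - b : ℂ).re = b.re * (2 * q.re - Complex.normSq q) / Complex.normSq q := by
        rw [show (2 * b.re / q : ℂ) = ((2 * b.re : ℝ) : ℂ) * q⁻¹ by push_cast; ring,
          Complex.sub_re, Complex.re_ofReal_mul, Complex.inv_re]
        field_simp
      rw [this]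
      have : 0 < 2 * q.re - Complex.normSq q := by linarith
      positivity
    have h1 := (h _ hx).2
    rw [sub_add_cancel, Complex.sub_re] at h1
    have h2 : e / (2 * b.re / q) = (((2 * b.re)⁻¹ : ℝ) : ℂ) * (e + ((s * ‖e‖ : ℝ) : ℂ)) := by
      have h3 : e * (starRingEnd ℂ) e = ‖e‖ ^ 2 := Complex.mul_conj' e
      rw [hq]
      push_cast
      field_simp
      linear_combination (s : ℂ) * h3
    rw [h2, Complex.re_ofReal_mul, Complex.add_re, Complex.ofReal_re, hsn] at h1
    have : (2 * b.re)⁻¹ * (e.re + (2 * b.re ^ 2 - e.re)) = b.re := by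
      field_simp
      ring
    linarith

/-- The Schwarz–Pick inequality for the Möbius maps `x ↦ b - e / (x + b)`. -/
theorem re_mul_norm_le_of_re_conditions {b e : ℂ}
    (h : (b.re = 0 ∧ e.im = 0 ∧ e.re < 0) ∨ (0 < b.re ∧ e.re + ‖e‖ ≤ 2 * b.re ^ 2))
    {x : ℂ} (hx : 0 < x.re) :
    x + b ≠ 0 ∧ x.re * ‖e / (x + b) ^ 2‖ ≤ (b - e / (x + b)).re := by
  have hb : 0 ≤ b.re := by rcases h with h | h <;> linarith [h.1]
  have hv : x + b ≠ 0 := by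
    intro e
    have := congrArg Complex.re e
    simp at this
    linarith
  refine ⟨hv, ?_⟩
  set v := x + b with hvdef
  have hxr : x.re = v.re - b.re := by simp [hvdef]
  have hn := Complex.normSq_pos.2 hv
  have e1 : ‖e / v ^ 2‖ = ‖e‖ / Complex.normSq v := by
    rw [norm_div, norm_pow, Complex.normSq_eq_norm_sq]
  have e2 : (e / v).re = (e.re * v.re + e.im * v.im) / Complex.normSq v := by
    rw [Complex.div_re]
    ring
  rw [Complex.sub_re, e1, e2, hxr, mul_div_assoc', ← sub_nonneg]
  have e3 : b.re - (e.re * v.re + e.im * v.im) / Complex.normSq v -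
      (v.re - b.re) * ‖e‖ / Complex.normSq v =
      (b.re * Complex.normSq v - (e.re * v.re + e.im * v.im) - (v.re - b.re) * ‖e‖) /
        Complex.normSq v := by
    field_simp
  rw [e3]
  refine div_nonneg ?_ hn.le
  rcases h with ⟨h1, h2, h3⟩ | ⟨h1, h2⟩
  · have h4 : ‖e‖ = -e.re := by
      rw [← abs_of_neg h3, Complex.abs_re_eq_norm.2 h2]
    rw [h1, h2, h4]
    linarith
  · have hee : e.re ^ 2 + e.im ^ 2 = ‖e‖ ^ 2 := by
      rw [← Complex.normSq_eq_norm_sq, Complex.normSq_apply]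
      ring
    -- Completing the squares in `Re v` and `Im v` leaves exactly the slack in the hypothesis,
    -- multiplied by `2 |e|`.
    have key : 4 * b.re * (b.re * Complex.normSq v - (e.re * v.re + e.im * v.im) -
        (v.re - b.re) * ‖e‖) = (2 * b.re * v.re - (‖e‖ + e.re)) ^ 2 +
          (2 * b.re * v.im - e.im) ^ 2 + 2 * ‖e‖ * (2 * b.re ^ 2 - (e.re + ‖e‖)) := by
      rw [Complex.normSq_apply]
      linear_combination -hee
    have h5 : 0 ≤ 4 * b.re * (b.re * Complex.normSq v - (e.re * v.re + e.im * v.im) -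
        (v.re - b.re) * ‖e‖) := by
      rw [key]
      have := mul_nonneg (mul_nonneg zero_le_two (norm_nonneg e)) (sub_nonneg.2 h2)
      positivity
    exact nonneg_of_mul_nonneg_right h5 (by positivity)

/-! ### Solving the symmetry relation -/

theorem sub_I_mul_re (a : ℝ) (z : ℂ) : (z - Complex.I * a).re = z.re := by
  simp

/-- Solutions of the symmetry relation. -/
theorem SymbolSymm.classification (hs : SymbolSymm ℓ a f g) (hg : Continuous g) {z₀ : RHP}
    (h₀ : f z₀ ≠ 0) :
    (∃ μ δ : ℂ, 0 < μ.re ∧ (∀ w, (g w : ℂ) = μ) ∧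
      ∀ w, f w = δ / ((w : ℂ) + μ - Complex.I * a) ^ (ℓ + 2)) ∨
    (∃ γ lam : ℂ, 0 ≤ γ.re ∧ (∀ w, (g w : ℂ) = w + γ) ∧ ∀ w, f w = lam) ∨
    (∃ b e d : ℂ, e ≠ 0 ∧
      ((b.re = 0 ∧ e.im = 0 ∧ e.re < 0) ∨ (0 < b.re ∧ e.re + ‖e‖ ≤ 2 * b.re ^ 2)) ∧
      (∀ w, (g w : ℂ) = b - e / ((w : ℂ) - Complex.I * a + b)) ∧
      ∀ w, f w = d / ((w : ℂ) - Complex.I * a + b) ^ (ℓ + 2)) := by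
  obtain ⟨A, B, D, hAB, hrel⟩ := hs.exists_bilinear hg h₀
  by_cases hA : A = 0
  · right; left
    have hB : B ≠ 0 := by simpa [hA] using hAB
    have hgz : ∀ w, (g w : ℂ) = w + (D / B - Complex.I * a) := by
      intro w
      have := hrel w
      rw [hA] at this
      field_simp
      linear_combination this
    refine ⟨D / B - Complex.I * a, f z₀, ?_, hgz, fun w => ?_⟩
    · by_contra! hneg
      set γ := D / B - Complex.I * a
      -- If `Re γ < 0`, the point `-Re γ / 2` lies in the half-plane but its translate has real part
      -- `Re γ / 2 < 0`.
      have h1 := (g ⟨((-γ.re / 2 : ℝ) : ℂ), by simp only [Complex.ofReal_re]; linarith⟩).2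
      rw [hgz, Complex.add_re, Complex.ofReal_re] at h1
      linarith
    · have h1 := hs w z₀
      have h2 := add_sub_I_mul_ne_zero a w (g z₀)
      have h3 : (z₀ : ℂ) + g w - Complex.I * a = w + g z₀ - Complex.I * a := by
        rw [hgz, hgz]
        ring
      rw [h3] at h1
      exact mul_right_cancel₀ (pow_ne_zero _ h2) h1
  · set b := B / A with hb
    set e := b ^ 2 - D / A with he
    -- The bilinear relation factors because `z - ia` and `g z` enter its linear part with opposite
    -- coefficients; `e = 0` is the degenerate case of constant `g`.
    have hrel' : ∀ z : RHP, ((z : ℂ) - Complex.I * a + b) * (g z - b) = -e := by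
      intro z
      have := hrel z
      rw [he, hb]
      field_simp
      linear_combination A * this
    by_cases he0 : e = 0
    · left
      have hbre : 0 < b.re := by
        obtain ⟨z, hz⟩ : ∃ z : RHP, (z : ℂ) - Complex.I * a + b ≠ 0 := by
          by_contra! hall
          have h1 := hall ⟨1, by simp⟩
          have h2 := hall ⟨2, by simp⟩
          have : (1 : ℂ) = 0 := by linear_combination h2 - h1
          exact one_ne_zero this
        have h1 := hrel' z
        rw [he0, neg_zero] at h1
        have h2 := (mul_eq_zero.1 h1).resolve_left hz
        rw [← sub_eq_zero.1 h2]
        exact (g z).2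
      have hne : ∀ z : RHP, (z : ℂ) + b - Complex.I * a ≠ 0 := fun z =>
        add_sub_I_mul_ne_zero a z ⟨b, hbre⟩
      have hgz : ∀ w, (g w : ℂ) = b := by
        intro z
        have h1 := hrel' z
        rw [he0, neg_zero] at h1
        refine sub_eq_zero.1 ((mul_eq_zero.1 h1).resolve_left ?_)
        rw [sub_add_eq_add_sub]
        exact hne z
      refine ⟨b, f z₀ * ((z₀ : ℂ) + b - Complex.I * a) ^ (ℓ + 2), hbre, hgz, fun w => ?_⟩
      have h1 := hs w z₀
      rw [hgz, hgz] at h1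
      rw [eq_div_iff (pow_ne_zero _ (hne w)), h1]
    · right; right
      have hne : ∀ z : RHP, (z : ℂ) - Complex.I * a + b ≠ 0 := by
        intro z hz
        have := hrel' z
        rw [hz, zero_mul] at this
        exact he0 (neg_eq_zero.1 this.symm)
      have hgz : ∀ w, (g w : ℂ) = b - e / ((w : ℂ) - Complex.I * a + b) := by
        intro w
        have h1 := hne w
        have := hrel' w
        field_simp
        linear_combination this
      refine ⟨b, e, f z₀ * ((z₀ : ℂ) - Complex.I * a + b) ^ (ℓ + 2), he0,
        re_conditions_of_forall_pos he0 fun x hx => ?_, hgz, fun w => ?_⟩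
      · have h1 : 0 < (x + Complex.I * a).re := by simpa using hx
        have h2 := hne ⟨_, h1⟩
        have h3 := (g ⟨_, h1⟩).2
        rw [hgz] at h3
        simp only [add_sub_cancel_right] at h2 h3
        exact ⟨h2, h3⟩
      · have h1 := hs w z₀
        have h2 := hne w
        have h3 := hne z₀
        have h4 := add_sub_I_mul_ne_zero a w (g z₀)
        -- Both sides equal `(w - ia + b) (z₀ - ia + b) - e`, which is symmetric in the two points.
        have e1 : ((w : ℂ) + g z₀ - Complex.I * a) * ((z₀ : ℂ) - Complex.I * a + b) =
            ((z₀ : ℂ) + g w - Complex.I * a) * ((w : ℂ) - Complex.I * a + b) := by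
          rw [hgz, hgz]
          field_simp
          ring
        have e2 := congrArg (· ^ (ℓ + 2)) e1
        simp only [mul_pow] at e2
        rw [eq_div_iff (pow_ne_zero _ h2)]
        apply mul_right_cancel₀ (pow_ne_zero (ℓ + 2) h4)
        linear_combination ((w : ℂ) - Complex.I * a + b) ^ (ℓ + 2) * h1 - f z₀ * e2

/-! ### The three families are symmetric and bounded -/

theorem symbolSymm_of_const {μ δ : ℂ} (hμ : 0 < μ.re) (hg : ∀ w, (g w : ℂ) = μ)
    (hf : ∀ w, f w = δ / ((w : ℂ) + μ - Complex.I * a) ^ (ℓ + 2)) : SymbolSymm ℓ a f g := by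
  intro z u
  have h1 := add_sub_I_mul_ne_zero a z ⟨μ, hμ⟩
  have h2 := add_sub_I_mul_ne_zero a u ⟨μ, hμ⟩
  simp only at h1 h2
  rw [hf, hf, hg, hg, div_mul_cancel₀ _ (pow_ne_zero _ h1), div_mul_cancel₀ _ (pow_ne_zero _ h2)]

theorem isBoundedOp_of_const_of_kernel {μ δ : ℂ} (hμ : 0 < μ.re) (hg : ∀ w, (g w : ℂ) = μ)
    (hf : ∀ w, f w = δ / ((w : ℂ) + μ - Complex.I * a) ^ (ℓ + 2)) :
    IsBoundedOp (wcompMax ℓ f g) := by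
  refine isBoundedOp_of_const (w := ⟨μ, hμ⟩)
    ((δ / kernelConst ℓ) • kernel ℓ (reflect a ⟨μ, hμ⟩)) (fun z => ?_) fun z => Subtype.ext (hg z)
  have hc := kernelConst_ne_zero ℓ
  rw [Bergman.smul_apply, kernel_apply, conj_reflect, hf, ← add_sub_assoc]
  field_simp

theorem symbolSymm_of_translation {γ lam : ℂ} (hg : ∀ w, (g w : ℂ) = w + γ)
    (hf : ∀ w, f w = lam) : SymbolSymm ℓ a f g := by
  intro z u
  rw [hf, hf, hg, hg]
  ring

theorem isBoundedOp_of_translation (hfa : IsAnalytic f) {γ lam : ℂ} (hγ : 0 ≤ γ.re)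
    (hg : ∀ w, (g w : ℂ) = w + γ) (hf : ∀ w, f w = lam) : IsBoundedOp (wcompMax ℓ f g) := by
  refine isBoundedOp_of_injOn hfa (C := ‖lam‖ ^ 2) (G := fun z => z + γ) (G' := fun _ => 1)
    (by positivity) hg (fun z _ => (hasDerivAt_id z).add_const γ)
    (add_left_injective γ).injOn (fun z => ?_) fun z => ?_
  · simp [hf]
  · simpa using hγ

theorem symbolSymm_of_moebius {b e d : ℂ}
    (hne : ∀ w : RHP, (w : ℂ) - Complex.I * a + b ≠ 0)
    (hg : ∀ w, (g w : ℂ) = b - e / ((w : ℂ) - Complex.I * a + b))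
    (hf : ∀ w, f w = d / ((w : ℂ) - Complex.I * a + b) ^ (ℓ + 2)) : SymbolSymm ℓ a f g := by
  intro z u
  have h1 := hne z
  have h2 := hne u
  have e1 : (z : ℂ) + g u - Complex.I * a = (((z : ℂ) - Complex.I * a + b) *
      ((u : ℂ) - Complex.I * a + b) - e) / ((u : ℂ) - Complex.I * a + b) := by
    rw [hg]
    field_simp
    ring
  have e2 : (u : ℂ) + g z - Complex.I * a = (((z : ℂ) - Complex.I * a + b) *
      ((u : ℂ) - Complex.I * a + b) - e) / ((z : ℂ) - Complex.I * a + b) := by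
    rw [hg]
    field_simp
    ring
  rw [e1, e2, hf, hf, div_pow, div_pow]
  field_simp

theorem isBoundedOp_of_moebius (hfa : IsAnalytic f) {b e d : ℂ} (he : e ≠ 0)
    (hcond : (b.re = 0 ∧ e.im = 0 ∧ e.re < 0) ∨ (0 < b.re ∧ e.re + ‖e‖ ≤ 2 * b.re ^ 2))
    (hg : ∀ w, (g w : ℂ) = b - e / ((w : ℂ) - Complex.I * a + b))
    (hf : ∀ w, f w = d / ((w : ℂ) - Complex.I * a + b) ^ (ℓ + 2)) :
    IsBoundedOp (wcompMax ℓ f g) := by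
  have hSP : ∀ z : ℂ, 0 < z.re → z - Complex.I * a + b ≠ 0 ∧
      z.re * ‖e / (z - Complex.I * a + b) ^ 2‖ ≤ (b - e / (z - Complex.I * a + b)).re := by
    intro z hz
    have h1 : 0 < (z - Complex.I * a).re := by rwa [sub_I_mul_re]
    have h2 := re_mul_norm_le_of_re_conditions hcond h1
    rwa [sub_I_mul_re] at h2
  -- Since `G' = e / (z - ia + b)²`, this `C` turns the bound on `‖f‖²` into an equality.
  refine isBoundedOp_of_injOn hfa (C := ‖d‖ ^ 2 / ‖e‖ ^ (ℓ + 2))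
    (G := fun z => b - e / (z - Complex.I * a + b))
    (G' := fun z => e / (z - Complex.I * a + b) ^ 2) (by positivity) hg (fun z hz => ?_)
    (fun z hz w hw h => ?_) (fun z => ?_) fun z => (hSP z z.2).2
  · have h1 : HasDerivAt (fun z : ℂ => z - Complex.I * a + b) 1 z :=
      ((hasDerivAt_id z).sub_const _).add_const b
    refine (((h1.inv (hSP z hz).1).const_mul e).const_sub b).congr_deriv ?_
    ring
  · have h1 := (hSP z hz).1
    have h2 := (hSP w hw).1
    simp only [sub_right_inj] at h
    rw [div_eq_div_iff h1 h2] at h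
    linear_combination -(mul_left_cancel₀ he h)
  · have h1 := norm_ne_zero_iff.2 (hSP z z.2).1
    have h2 := norm_ne_zero_iff.2 he
    rw [hf, norm_div, norm_div, norm_pow, norm_pow, div_pow, div_pow]
    apply le_of_eq
    field_simp
    ring

theorem moebius_re_conditions_iff {α β : ℂ} :
    (((-(β / α)).re = 0 ∧ (2 / α).im = 0 ∧ (2 / α).re < 0) ∨
      (0 < (-(β / α)).re ∧ (2 / α).re + ‖2 / α‖ ≤ 2 * (-(β / α)).re ^ 2)) ↔
    (((β / α).re = 0 ∧ (1 / α).im = 0 ∧ (1 / α).re < 0) ∨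
      ((β / α).re < 0 ∧ (1 / α).re + 1 / ‖α‖ ≤ (β / α).re ^ 2)) := by
  have h1 : (2 / α).re = 2 * (1 / α).re := by
    rw [show 2 / α = ((2 : ℝ) : ℂ) * (1 / α) by push_cast; ring, Complex.re_ofReal_mul]
  have h2 : (2 / α).im = 2 * (1 / α).im := by
    rw [show 2 / α = ((2 : ℝ) : ℂ) * (1 / α) by push_cast; ring, Complex.im_ofReal_mul]
  have h3 : ‖2 / α‖ = 2 * (1 / ‖α‖) := by
    rw [norm_div, Complex.norm_ofNat]
    ring
  rw [h1, h2, h3, Complex.neg_re, neg_sq, ← mul_add]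
  refine or_congr (and_congr neg_eq_zero (and_congr (by simp) ?_)) (and_congr neg_pos ?_)
  · constructor <;> intro h <;> linarith
  · constructor <;> intro h <;> linarith

theorem isBoundedOp_and_symbolSymm (hfa : IsAnalytic f)
    (h : (∀ w, f w = 0) ∨
      (∃ μ δ : ℂ, 0 < μ.re ∧
        (∀ w, (g w : ℂ) = μ) ∧
        (∀ w, f w = δ / ((w : ℂ) + μ - Complex.I * a) ^ (ℓ + 2))) ∨
      (∃ γ lam : ℂ, 0 ≤ γ.re ∧
        (∀ w, (g w : ℂ) = w + γ) ∧
        (∀ w, f w = lam)) ∨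
      (∃ b e d : ℂ, e ≠ 0 ∧
        ((b.re = 0 ∧ e.im = 0 ∧ e.re < 0) ∨ (0 < b.re ∧ e.re + ‖e‖ ≤ 2 * b.re ^ 2)) ∧
        (∀ w, (g w : ℂ) = b - e / ((w : ℂ) - Complex.I * a + b)) ∧
        ∀ w, f w = d / ((w : ℂ) - Complex.I * a + b) ^ (ℓ + 2))) :
    IsBoundedOp (wcompMax ℓ f g) ∧ SymbolSymm ℓ a f g := by
  rcases h with h | ⟨μ, δ, hμ, hg, hf⟩ | ⟨γ, lam, hγ, hg, hf⟩ | ⟨b, e, d, he, hcond, hg, hf⟩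
  · exact ⟨isBoundedOp_of_forall_eq_zero h, fun z u => by rw [h, h, zero_mul, zero_mul]⟩
  · exact ⟨isBoundedOp_of_const_of_kernel hμ hg hf, symbolSymm_of_const hμ hg hf⟩
  · exact ⟨isBoundedOp_of_translation hfa hγ hg hf, symbolSymm_of_translation hg hf⟩
  · refine ⟨isBoundedOp_of_moebius hfa he hcond hg hf, symbolSymm_of_moebius (fun w => ?_) hg hf⟩
    exact (re_mul_norm_le_of_re_conditions hcond
      (show 0 < ((w : ℂ) - Complex.I * a).re by rw [sub_I_mul_re]; exact w.2)).1

/-- The two parametrisations correspond through `e = 2 / α`, `b = -β / α` and `d = δ / α^(ℓ+2)`. The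
form in `b` and `e` suits the computations, the one in `α` and `β` is that of the theorem. -/
theorem moebius_form_iff :
    (∃ b e d : ℂ, e ≠ 0 ∧
        ((b.re = 0 ∧ e.im = 0 ∧ e.re < 0) ∨ (0 < b.re ∧ e.re + ‖e‖ ≤ 2 * b.re ^ 2)) ∧
        (∀ w, (g w : ℂ) = b - e / ((w : ℂ) - Complex.I * a + b)) ∧
        ∀ w, f w = d / ((w : ℂ) - Complex.I * a + b) ^ (ℓ + 2)) ↔
    (∃ α β δ : ℂ, α ≠ 0 ∧
        (((β / α).re = 0 ∧ (1 / α).im = 0 ∧ (1 / α).re < 0) ∨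
          ((β / α).re < 0 ∧ (1 / α).re + 1 / ‖α‖ ≤ (β / α).re ^ 2)) ∧
        (∀ w, (g w : ℂ) = -(β / α) - 2 / (α * ((w : ℂ) - Complex.I * a) - β)) ∧
        (∀ w, f w = δ / (α * ((w : ℂ) - Complex.I * a) - β) ^ (ℓ + 2))) := by
  have key : ∀ α β x : ℂ, α ≠ 0 → α * x - β = α * (x + -(β / α)) := by
    intro α β x hα
    field_simp
    ring
  constructor
  · rintro ⟨b, e, d, he, hcond, hg, hf⟩
    have hα : 2 / e ≠ 0 := div_ne_zero two_ne_zero he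
    have hb : -(-b * (2 / e) / (2 / e)) = b := by
      rw [mul_div_cancel_right₀ _ hα, neg_neg]
    have he' : 2 / (2 / e) = e := by field_simp
    refine ⟨2 / e, -b * (2 / e), d * (2 / e) ^ (ℓ + 2), hα, ?_, fun w => ?_, fun w => ?_⟩
    · rw [← moebius_re_conditions_iff, hb, he']
      exact hcond
    · rw [key _ _ _ hα, hb, ← div_div, he']
      exact hg w
    · rw [key _ _ _ hα, hb, mul_pow, mul_comm d, mul_div_mul_left _ _ (pow_ne_zero _ hα)]
      exact hf w
  · rintro ⟨α, β, δ, hα, hcond, hg, hf⟩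
    refine ⟨-(β / α), 2 / α, δ / α ^ (ℓ + 2), div_ne_zero two_ne_zero hα,
      moebius_re_conditions_iff.2 hcond, fun w => ?_, fun w => ?_⟩
    · rw [hg, key _ _ _ hα, div_div]
    · rw [hf, key _ _ _ hα, div_div, mul_pow]

end BergmanHP

end

theorem mainTheorem4 (ℓ : ℕ) (a : ℝ) (f : BergmanHP.RHP → ℂ) (g : BergmanHP.RHP → BergmanHP.RHP)
    (hf : BergmanHP.IsAnalytic f) (hg : BergmanHP.IsAnalytic (fun w => (g w : ℂ))) :
    (BergmanHP.IsCSelfadjoint (BergmanHP.conjugation ℓ a) (BergmanHP.wcompMax ℓ f g) ↔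
      (∀ w, f w = 0) ∨
      (∃ μ δ : ℂ, 0 < μ.re ∧
        (∀ w, (g w : ℂ) = μ) ∧
        (∀ w, f w = δ / ((w : ℂ) + μ - Complex.I * a) ^ (ℓ + 2))) ∨
      (∃ γ lam : ℂ, 0 ≤ γ.re ∧
        (∀ w, (g w : ℂ) = w + γ) ∧
        (∀ w, f w = lam)) ∨
      (∃ α β δ : ℂ, α ≠ 0 ∧
        (((β / α).re = 0 ∧ (1 / α).im = 0 ∧ (1 / α).re < 0) ∨
          ((β / α).re < 0 ∧ (1 / α).re + 1 / ‖α‖ ≤ (β / α).re ^ 2)) ∧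
        (∀ w, (g w : ℂ) = -(β / α) - 2 / (α * ((w : ℂ) - Complex.I * a) - β)) ∧
        (∀ w, f w = δ / (α * ((w : ℂ) - Complex.I * a) - β) ^ (ℓ + 2)))) ∧
    (BergmanHP.IsCSelfadjoint (BergmanHP.conjugation ℓ a) (BergmanHP.wcompMax ℓ f g) →
      BergmanHP.IsBoundedOp (BergmanHP.wcompMax ℓ f g)) := by
  rw [← BergmanHP.moebius_form_iff]
  have hg' : Continuous g := hg.continuous.subtype_mk fun w => (g w).2
  -- Here `P` is selfadjointness, `Q` the list of symbols, `R` boundedness and `S` the symmetry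
  -- relation.
  refine (show ∀ {P Q R S : Prop}, (P → Q) → (Q → R ∧ S) → (R → S → P) → (P ↔ Q) ∧ (P → R) by
    tauto) (fun h => ?_) (BergmanHP.isBoundedOp_and_symbolSymm hf)
    BergmanHP.isCSelfadjoint_of_symbolSymm
  by_cases hf0 : ∀ w, f w = 0
  · exact Or.inl hf0
  · push Not at hf0
    obtain ⟨z₀, h₀⟩ := hf0
    exact Or.inr ((BergmanHP.symbolSymm_of_isCSelfadjoint h).classification hg' h₀)
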